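/- $\mathsf{RCA}_0$ proves the following. Let $Q=(Q,\leq_Q)$ be a quasi-order (a set $Q\subseteq\mathbb N$ with a reflexive and transitive relation $\leq_Q$ on it that is also a set). (i) If $\mathrm{alex}(Q)$ is Noetherian, then $\mathrm{upper}(Q)$ is Noetherian. (ii) $Q$ is a wqo if and only if $\mathrm{alex}(Q)$ is Noetherian. Here "$\mathsf{RCA}_0$ proves" means: the assertion is true in every model $(M,S)$ of $\mathsf{RCA}_0$ (equivalently, by Gödel's completeness theorem, derivable from $\mathsf{RCA}_0$), where $M$ is a possibly nonstandard first-order part, $S\subseteq\mathcal P(M)$ is the range of the set variables, and the axioms of $\mathsf{RCA}_0$ are those of a discretely ordered commutative semiring with identity (with all elements nonnegative and with differences $y-x$ for $x<y$), $\Sigma^0_1$ induction and $\Delta^0_1$ comprehension, both with arbitrary number and set parameters. All notions below are interpreted in $(M,S)$, with $\mathbb N$ standing for $M$ and all sets and functions belonging to $S$; pairs are coded by $(i,j)=(i+j)^2+i$, and a finite set is coded by the least triple $(k,(m,n))$ for which the set is $\{i<k : m(i+1)+1 \text{ divides } n\}$. $\mathcal P_{\mathrm f}(A)$ denotes the set of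 codes of finite subsets of $A$. * $Q$ is a *wqo* if for every function $f:\mathbb N\to Q$ there are $m<n$ with $f(m)\leq_Q f(n)$. * A *countable second-countable space* is a triple $(X,(U_i)_{i\in I},k)$ with $U_i\subseteq X$ and $k:X\times I\times I\to I$, such that every $x\in X$ is in some $U_i$, and $x\in U_i\cap U_j$ implies $x\in U_{k(x,i,j)}\subseteq U_i\cap U_j$. A function $h:\mathbb N\to\mathcal P_{\mathrm f}(I)$ codes the effectively open set $G_h=\bigcup_{n}\bigcup_{i\in h(n)}U_i$ (as a formula; it need not exist as a set). $G_h$ is *compact* if for every $f:\mathbb N\to\mathcal P_{\mathrm f}(I)$ with $G_h\subseteq G_f$ there is an $N$ with $G_h\subseteq\bigcup_{n<N}\bigcup_{i\in f(n)}U_i$. The space is *Noetherian* if every effectively open set is compact. * $\mathrm{alex}(Q)$ is the space $(Q,(U_q)_{q\in Q},k)$ with $U_q=\{x\in Q: q\leq_Q x\}$ and $k(q,p,r)=q$. * $\mathrm{upper}(Q)$ is the space $(Q,(V_c)_{c\in\mathcal P_{\mathrm f}(Q)},\ell)$ with $V_c=\{x\in Q: x\not\leq_Q p\text{ for all }p\in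 c\}$ and $\ell(q,c,d)=c\cup d$. -/

import Mathlib

/-! Second-order arithmetic. A structure for its two-sorted language consists of a first-order part
`M` (with `0, 1, +, *, <`) and a family `S : Set (Set M)` over which the set variables range. -/

namespace SOA

universe u

/-! ### Bounded-quantifier formulas of second-order arithmetic -/

/-- Numerical terms; `var n` is the number variable with de Bruijn index `n`. -/
inductive NumTerm : Type
  | var (n : ℕ)
  | zero
  | one
  | add (s t : NumTerm)
  | mul (s t : NumTerm)

/-- Formulas of second-order arithmetic all of whose quantifiers are bounded number quantifiers
(`Δ⁰₀` formulas). Set variables `i : ℕ` occur only as parameters, in the atoms `t ∈ X_i`. In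
`ball t φ` (`∀ x < t, φ`) and `bex t φ` (`∃ x < t, φ`) the bound variable is the variable `0` of
`φ`, and `t` belongs to the outer context (so `x` does not occur in `t`). -/
inductive BddFormula : Type
  | eq (s t : NumTerm)
  | lt (s t : NumTerm)
  | mem (t : NumTerm) (i : ℕ)
  | neg (φ : BddFormula)
  | and (φ ψ : BddFormula)
  | or (φ ψ : BddFormula)
  | ball (t : NumTerm) (φ : BddFormula)
  | bex (t : NumTerm) (φ : BddFormula)

/-- Extend an assignment of the number variables by a new value for the variable `0`. -/
def push {M : Type u} (a : M) (v : ℕ → M) : ℕ → M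
  | 0 => a
  | n + 1 => v n

section Semantics

variable {M : Type u} [CommSemiring M] [LinearOrder M]

/-- The value of a term. -/
def NumTerm.eval (v : ℕ → M) : NumTerm → M
  | .var n => v n
  | .zero => 0
  | .one => 1
  | .add s t => s.eval v + t.eval v
  | .mul s t => s.eval v * t.eval v

/-- Truth of a bounded-quantifier formula in `M`, under an assignment `V` of the set variables and
an assignment `v` of the number variables. -/
def BddFormula.Holds (V : ℕ → Set M) : BddFormula → (ℕ → M) → Prop
  | .eq s t, v => s.eval v = t.eval v
  | .lt s t, v => s.eval v < t.eval v
  | .mem t i, v => t.eval v ∈ V i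
  | .neg φ, v => ¬ φ.Holds V v
  | .and φ ψ, v => φ.Holds V v ∧ ψ.Holds V v
  | .or φ ψ, v => φ.Holds V v ∨ ψ.Holds V v
  | .ball t φ, v => ∀ a, a < t.eval v → φ.Holds V (push a v)
  | .bex t φ, v => ∃ a, a < t.eval v ∧ φ.Holds V (push a v)

/-- The `Σ⁰₁` formula `∃ m θ(m, n)` at the argument `n`; the other variables are parameters. -/
def SigmaHolds (θ : BddFormula) (V : ℕ → Set M) (v : ℕ → M) (n : M) : Prop :=
  ∃ m, θ.Holds V (push m (push n v))

/-- The `Π⁰₁` formula `∀ m θ(m, n)` at the argument `n`; the other variables are parameters. -/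
def PiHolds (θ : BddFormula) (V : ℕ → Set M) (v : ℕ → M) (n : M) : Prop :=
  ∀ m, θ.Holds V (push m (push n v))

end Semantics

/-- `(M, S)` is a model of `RCA₀`: `M` is a discretely ordered commutative semiring (its elements are
all nonnegative, and smaller elements can be subtracted from larger ones), and `(M, S)` satisfies
every instance, with arbitrary number and set parameters, of `Σ⁰₁` induction and of `Δ⁰₁`
comprehension. `M` need not be the standard `ℕ`, and `S` need not contain all subsets of `M`. -/
structure IsModelRCA0 (M : Type u) [CommSemiring M] [LinearOrder M] [IsStrictOrderedRing M]
    (S : Set (Set M)) : Prop where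
  zero_le : ∀ x : M, 0 ≤ x
  lt_iff_add_one_le : ∀ x y : M, x < y ↔ x + 1 ≤ y
  exists_add_of_lt : ∀ x y : M, x < y → ∃ z, x + z = y
  /-- The range of the set variables is nonempty, as in any two-sorted structure. -/
  sets_nonempty : S.Nonempty
  sigma_induction : ∀ (θ : BddFormula) (V : ℕ → Set M) (v : ℕ → M), (∀ i, V i ∈ S) →
    SigmaHolds θ V v 0 → (∀ n, SigmaHolds θ V v n → SigmaHolds θ V v (n + 1)) →
    ∀ n, SigmaHolds θ V v n
  delta_comprehension : ∀ (θ η : BddFormula) (V : ℕ → Set M) (v : ℕ → M), (∀ i, V i ∈ S) →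
    (∀ n, SigmaHolds θ V v n ↔ PiHolds η V v n) → {n | SigmaHolds θ V v n} ∈ S

/-! ### Codes for pairs, finite sets and functions

From here on everything is spelled out inside a structure `(M, S)`: "number" means element of `M`,
and "set" means member of `S`. -/

section Coding

variable {M : Type u} [CommSemiring M] [LinearOrder M]

/-- The code `(i + j)² + i` of the ordered pair `(i, j)`. -/
def pair (i j : M) : M := (i + j) * (i + j) + i

/-- The set of (codes of) pairs with components in `A` and `B`. -/
def prodSet (A B : Set M) : Set M := {z | ∃ a ∈ A, ∃ b ∈ B, z = pair a b}

/-- `c` is of the form `(k, (m, n))`. -/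
def IsTriple (c : M) : Prop := ∃ k m n : M, c = pair k (pair m n)

/-- `i` is an element of the finite set represented by `c = (k, (m, n))`, which is
`{i < k : m (i + 1) + 1 divides n}`. -/
def FinMem (i c : M) : Prop :=
  ∃ k m n : M, c = pair k (pair m n) ∧ i < k ∧ m * (i + 1) + 1 ∣ n

/-- `c` is the code of a finite set: the least number that represents it. -/
def IsFinCode (c : M) : Prop :=
  IsTriple c ∧ ∀ d, d < c → IsTriple d → ¬ ∀ i, FinMem i d ↔ FinMem i c

/-- The set of codes of finite subsets of `A`. -/
def Pfin (A : Set M) : Set M := {c | IsFinCode c ∧ ∀ i, FinMem i c → i ∈ A}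

/-- `f` is (the graph of) a function from `A` to `B`. -/
def IsFun (A B f : Set M) : Prop :=
  f ⊆ prodSet A B ∧ ∀ a ∈ A, ∃! b, b ∈ B ∧ pair a b ∈ f

/-! ### Quasi-orders -/

/-- `(Q, L)` is a quasi-order of the structure `(M, S)`; `p ≤ q` means `pair p q ∈ L`. -/
structure IsQuasiOrder (S : Set (Set M)) (Q L : Set M) : Prop where
  carrier_mem : Q ∈ S
  rel_mem : L ∈ S
  rel_subset : L ⊆ prodSet Q Q
  refl : ∀ q ∈ Q, pair q q ∈ L
  trans : ∀ p ∈ Q, ∀ q ∈ Q, ∀ r ∈ Q, pair p q ∈ L → pair q r ∈ L → pair p r ∈ L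

/-- `(Q, L)` is a well-quasi-order in `(M, S)`: for every function `f : M → Q` in `S` there are
`m < n` with `f m ≤ f n`. -/
def IsWQO (S : Set (Set M)) (Q L : Set M) : Prop :=
  IsQuasiOrder S Q L ∧ ∀ f ∈ S, IsFun Set.univ Q f →
    ∃ m n a b, m < n ∧ pair m a ∈ f ∧ pair n b ∈ f ∧ pair a b ∈ L

/-! ### Countable second-countable spaces -/

/-- The data of a countable second-countable space: the set `X` of points, the index set `I`, the
sequence `(U_i)` coded by `U = {(x, i) : x ∈ U_i}`, and the function `k : X × I × I → I`. -/
structure CSC (M : Type u) where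
  X : Set M
  I : Set M
  U : Set M
  k : Set M

/-- The data belong to `(M, S)`, and `((U_i), k)` is a base for a topology on `X`. -/
structure CSC.IsSpace (S : Set (Set M)) (D : CSC M) : Prop where
  X_mem : D.X ∈ S
  I_mem : D.I ∈ S
  U_mem : D.U ∈ S
  k_mem : D.k ∈ S
  U_subset : D.U ⊆ prodSet D.X D.I
  k_fun : IsFun (prodSet D.X (prodSet D.I D.I)) D.I D.k
  cover : ∀ x ∈ D.X, ∃ i ∈ D.I, pair x i ∈ D.U
  inter : ∀ x ∈ D.X, ∀ i ∈ D.I, ∀ j ∈ D.I, ∀ l ∈ D.I,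
    pair x i ∈ D.U → pair x j ∈ D.U → pair (pair x (pair i j)) l ∈ D.k →
    pair x l ∈ D.U ∧ ∀ y, pair y l ∈ D.U → pair y i ∈ D.U ∧ pair y j ∈ D.U

/-- `h` codes an effectively open set: it is a function in `S` from numbers to finite subsets
of `I`. -/
def CSC.IsOpenCode (S : Set (Set M)) (D : CSC M) (h : Set M) : Prop :=
  h ∈ S ∧ IsFun Set.univ (Pfin D.I) h

/-- `x` belongs to the union of the `U_i` with `i ∈ h(n)`. -/
def CSC.MemAt (D : CSC M) (h : Set M) (x n : M) : Prop :=
  ∃ c i, pair n c ∈ h ∧ FinMem i c ∧ pair x i ∈ D.U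

/-- `x ∈ G_h`, where `G_h` is the union over all `n` and all `i ∈ h(n)` of `U_i`. -/
def CSC.MemOpen (D : CSC M) (h : Set M) (x : M) : Prop := ∃ n, D.MemAt h x n

/-- The effectively open set `G_h` is compact. -/
def CSC.IsCompactOpen (S : Set (Set M)) (D : CSC M) (h : Set M) : Prop :=
  ∀ f, D.IsOpenCode S f → (∀ x, D.MemOpen h x → D.MemOpen f x) →
    ∃ N, ∀ x, D.MemOpen h x → ∃ n, n < N ∧ D.MemAt f x n

/-- A countable second-countable space is Noetherian if every effectively open set is compact. -/
def CSC.IsNoetherian (S : Set (Set M)) (D : CSC M) : Prop :=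
  D.IsSpace S ∧ ∀ h, D.IsOpenCode S h → D.IsCompactOpen S h

/-- The Alexandroff topology of `(Q, L)`: `I = Q`, `U_q = {x ∈ Q : q ≤ x}` and `k(q, p, r) = q`. -/
def alex (Q L : Set M) : CSC M where
  X := Q
  I := Q
  U := {z | ∃ x ∈ Q, ∃ q ∈ Q, z = pair x q ∧ pair q x ∈ L}
  k := {z | ∃ q ∈ Q, ∃ p ∈ Q, ∃ r ∈ Q, z = pair (pair q (pair p r)) q}

/-- The upper topology of `(Q, L)`: the index set consists of (the codes of) the finite subsets of
`Q`, `U_c = {x ∈ Q : ¬ x ≤ p for every p ∈ c}` and `k(q, c, d) = c ∪ d`. -/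
def upper (Q L : Set M) : CSC M where
  X := Q
  I := Pfin Q
  U := {z | ∃ x ∈ Q, ∃ c ∈ Pfin Q, z = pair x c ∧ ∀ p, FinMem p c → pair x p ∉ L}
  k := {z | ∃ q ∈ Q, ∃ c ∈ Pfin Q, ∃ d ∈ Pfin Q, ∃ e ∈ Pfin Q,
    z = pair (pair q (pair c d)) e ∧ ∀ i, FinMem i e ↔ FinMem i c ∨ FinMem i d}

end Coding

end SOA

/-!
Open sets of both topologies are upward closed. For an effectively open set of `upper(Q)`, the
statement that `q` is covered at stage `m` is `Δ⁰₁` in `m` and `q`, so putting the generator `q`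
into the stage `(m, q)` for each such pair yields an effectively open set of `alex(Q)` with the same
points. As `m ≤ (m, q)`, this also translates finite subcovers back, which is (i).

If `alex(Q)` is Noetherian and `f : ℕ → Q`, then the union of the cones above the points `f m` is
covered by finitely many of them, so `f n` for large `n` lies above some `f m` with `m < n`.
Conversely, suppose that no finite part of a cover `G_f` of some `G_h` suffices. Iterating a choice
function gives a sequence such that `x_m` is covered at a stage at which `x_n` is not, for all
`m < n`. As open sets are upward closed, `x_m ≰ x_n`, so `Q` is not a wqo.

All of these objects have to exist in the second-order part of the model: codes of finite sets come
from Gödel's `β` function, bounded quantifiers in front of `Σ⁰₁` formulas are absorbed by `Σ⁰₁`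
collection, and a sequence defined by iteration is read off codes of its finite initial parts.
-/

namespace SOA

universe u

/-- Substitution of the term `σ n` for each number variable `n`. -/
def NumTerm.subst (σ : ℕ → NumTerm) : NumTerm → NumTerm
  | .var n => σ n
  | .zero => .zero
  | .one => .one
  | .add s t => .add (s.subst σ) (t.subst σ)
  | .mul s t => .mul (s.subst σ) (t.subst σ)

/-- The substitution `σ` carried under a quantifier, where `0` is the newly bound variable. -/
def liftSubst (σ : ℕ → NumTerm) : ℕ → NumTerm
  | 0 => .var 0
  | n + 1 => (σ n).subst fun i => .var (i + 1)

/-- Substitution of `σ n` for each number variable `n` and of `f i` for each set variable `i`. -/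
def BddFormula.subst (f : ℕ → ℕ) : BddFormula → (ℕ → NumTerm) → BddFormula
  | .eq s t, σ => .eq (s.subst σ) (t.subst σ)
  | .lt s t, σ => .lt (s.subst σ) (t.subst σ)
  | .mem t i, σ => .mem (t.subst σ) (f i)
  | .neg φ, σ => .neg (φ.subst f σ)
  | .and φ ψ, σ => .and (φ.subst f σ) (ψ.subst f σ)
  | .or φ ψ, σ => .or (φ.subst f σ) (ψ.subst f σ)
  | .ball t φ, σ => .ball (t.subst σ) (φ.subst f (liftSubst σ))
  | .bex t φ, σ => .bex (t.subst σ) (φ.subst f (liftSubst σ))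

section Substitution

variable {M : Type u} [CommSemiring M]

theorem NumTerm.eval_subst (σ : ℕ → NumTerm) (v : ℕ → M) (t : NumTerm) :
    (t.subst σ).eval v = t.eval fun n => (σ n).eval v := by
  induction t with
  | var n => rfl
  | zero => rfl
  | one => rfl
  | add s t hs ht => simp only [subst, eval, hs, ht]
  | mul s t hs ht => simp only [subst, eval, hs, ht]

theorem eval_liftSubst (σ : ℕ → NumTerm) (a : M) (v : ℕ → M) :
    (fun n => (liftSubst σ n).eval (push a v)) = push a fun n => (σ n).eval v := by
  funext n
  cases n with
  | zero => rfl
  | succ n => exact NumTerm.eval_subst _ _ _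

theorem BddFormula.holds_subst [LinearOrder M] (f : ℕ → ℕ) (σ : ℕ → NumTerm) (V : ℕ → Set M)
    (v : ℕ → M) (φ : BddFormula) :
    (φ.subst f σ).Holds V v ↔ φ.Holds (V ∘ f) fun n => (σ n).eval v := by
  induction φ generalizing σ v <;>
    simp only [subst, Holds, NumTerm.eval_subst, eval_liftSubst, Function.comp_apply, *]

end Substitution

/-- `Γ` is a type of nonempty tuples of elements of `M`. A tuple `v` and a sequence `p` of
parameters are combined into the assignment `assign v p`, in which the entries of `v` come first. -/
class Tuple (M : Type u) (Γ : Type u) where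
  length : ℕ
  assign : Γ → (ℕ → M) → ℕ → M
  assign_add_length : ∀ v p n, assign v p (n + length) = p n
  assign_eq_of_lt : ∀ v p q n, n < length → assign v p n = assign v q n

namespace Tuple

variable {M : Type u} {Γ : Type u} [Tuple M Γ]

instance single : Tuple M M where
  length := 1
  assign := push
  assign_add_length _ _ _ := rfl
  assign_eq_of_lt _ _ _ n hn := by obtain rfl := Nat.lt_one_iff.1 hn; rfl

instance prod : Tuple M (M × Γ) where
  length := length M Γ + 1
  assign v p := push v.1 (assign v.2 p)
  assign_add_length v p n := assign_add_length v.2 p n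
  assign_eq_of_lt v p q n hn := by
    cases n with
    | zero => rfl
    | succ n => exact assign_eq_of_lt v.2 p q n (Nat.lt_of_succ_lt_succ hn)

variable (M Γ) in
/-- The variables behind those of a tuple of type `Γ`, which hold the parameters, moved by `e`. -/
def moveParams (e : ℕ → ℕ) (n : ℕ) : ℕ :=
  if n < length M Γ then n else e (n - length M Γ) + length M Γ

theorem assign_moveParams (e : ℕ → ℕ) (v : Γ) (p : ℕ → M) (n : ℕ) :
    assign v p (moveParams M Γ e n) = assign v (p ∘ e) n := by
  by_cases hn : n < length M Γ
  · rw [moveParams, if_pos hn]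
    exact assign_eq_of_lt v _ _ n hn
  · obtain ⟨k, rfl⟩ := Nat.exists_eq_add_of_le' (not_lt.1 hn)
    rw [moveParams, if_neg hn, Nat.add_sub_cancel, assign_add_length, assign_add_length,
      Function.comp_apply]

end Tuple

/-- The sequence that runs through `p` at the even and through `q` at the odd places. -/
def interleave {α : Type u} (p q : ℕ → α) (n : ℕ) : α := if Even n then p (n / 2) else q (n / 2)

theorem interleave_comp_even {α : Type u} (p q : ℕ → α) :
    (interleave p q ∘ fun n => 2 * n) = p := by
  funext n
  simp [interleave]

theorem interleave_comp_odd {α : Type u} (p q : ℕ → α) :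
    (interleave p q ∘ fun n => 2 * n + 1) = q := by
  funext n
  have half : (2 * n + 1) / 2 = n := by lia
  simp [interleave, half]

section Polynomial

variable {M : Type u} [CommSemiring M] {Γ Δ Θ : Type u} [Tuple M Γ] [Tuple M Δ] [Tuple M Θ]

variable (M) in
/-- `f` is a polynomial map, with parameters from `M`, between two types of tuples. With every
sequence `p` of parameters of the codomain being allowed, substitution of `f v` into a formula needs
no change of the parameters of that formula. -/
@[fun_prop]
def IsPoly (f : Γ → Δ) : Prop :=
  ∀ p : ℕ → M, ∃ (σ : ℕ → NumTerm) (q : ℕ → M),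
    ∀ v n, Tuple.assign (f v) p n = (σ n).eval (Tuple.assign v q)

namespace IsPoly

@[fun_prop]
theorem id : IsPoly M fun v : Γ => v := fun p => ⟨.var, p, fun _ _ => rfl⟩

@[fun_prop]
theorem comp {g : Δ → Θ} {f : Γ → Δ} (hg : IsPoly M g) (hf : IsPoly M f) :
    IsPoly M fun v => g (f v) := by
  intro p
  obtain ⟨σ, q, hσ⟩ := hg p
  obtain ⟨τ, r, hτ⟩ := hf q
  refine ⟨fun n => (σ n).subst τ, r, fun v n => ?_⟩
  rw [hσ, NumTerm.eval_subst, funext fun i => hτ v i]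

@[fun_prop]
theorem const (d : Δ) : IsPoly M fun _ : Γ => d := fun p =>
  ⟨fun n => .var (n + Tuple.length M Γ), Tuple.assign d p, fun v n =>
    (Tuple.assign_add_length v _ n).symm⟩

theorem fst : IsPoly M fun v : M × Γ => v.1 := fun p =>
  ⟨fun | 0 => .var 0 | n + 1 => .var (n + Tuple.length M Γ + 1), p, fun
    | _, 0 => rfl
    | v, n + 1 => (Tuple.assign_add_length v.2 p n).symm⟩

theorem snd : IsPoly M fun v : M × Γ => v.2 := fun p =>
  ⟨fun n => .var (n + 1), p, fun _ _ => rfl⟩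

@[fun_prop]
theorem comp_fst {f : Γ → M × Δ} (hf : IsPoly M f) : IsPoly M fun v => (f v).1 := fst.comp hf

@[fun_prop]
theorem comp_snd {f : Γ → M × Δ} (hf : IsPoly M f) : IsPoly M fun v => (f v).2 := snd.comp hf

@[fun_prop]
theorem prodMk {f : Γ → M} {g : Γ → Δ} (hf : IsPoly M f) (hg : IsPoly M g) :
    IsPoly M fun v => (f v, g v) := by
  intro p
  obtain ⟨σ, q, hσ⟩ := hf p
  obtain ⟨τ, r, hτ⟩ := hg p
  refine ⟨fun
    | 0 => (σ 0).subst fun i => .var (Tuple.moveParams M Γ (fun k => 2 * k) i)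
    | n + 1 => (τ n).subst fun i => .var (Tuple.moveParams M Γ (fun k => 2 * k + 1) i),
    interleave q r, fun v n => ?_⟩
  cases n with
  | zero =>
    refine (hσ v 0).trans ?_
    simp only [NumTerm.eval_subst, NumTerm.eval, Tuple.assign_moveParams, interleave_comp_even]
  | succ n =>
    refine (hτ v n).trans ?_
    simp only [NumTerm.eval_subst, NumTerm.eval, Tuple.assign_moveParams, interleave_comp_odd]

@[fun_prop]
theorem add {f g : Γ → M} (hf : IsPoly M f) (hg : IsPoly M g) : IsPoly M fun v => f v + g v := by
  have add_pair : IsPoly M fun w : M × M => w.1 + w.2 := fun p =>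
    ⟨fun | 0 => .add (.var 0) (.var 1) | n + 1 => .var (n + 2), p, fun | _, 0 | _, _ + 1 => rfl⟩
  exact add_pair.comp (hf.prodMk hg)

@[fun_prop]
theorem mul {f g : Γ → M} (hf : IsPoly M f) (hg : IsPoly M g) : IsPoly M fun v => f v * g v := by
  have mul_pair : IsPoly M fun w : M × M => w.1 * w.2 := fun p =>
    ⟨fun | 0 => .mul (.var 0) (.var 1) | n + 1 => .var (n + 2), p, fun | _, 0 | _, _ + 1 => rfl⟩
  exact mul_pair.comp (hf.prodMk hg)

@[fun_prop]
theorem pair {f g : Γ → M} (hf : IsPoly M f) (hg : IsPoly M g) :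
    IsPoly M fun v => SOA.pair (f v) (g v) := by
  unfold SOA.pair
  fun_prop

end IsPoly

end Polynomial

section Bounded

variable {M : Type u} [CommSemiring M] [LinearOrder M] {S : Set (Set M)}
  {Γ Δ : Type u} [Tuple M Γ] [Tuple M Δ]

/-- `P` is defined by a bounded-quantifier formula with number parameters from `M` and set
parameters from `S`. The empty set is admitted as a value of the set variables that do not occur. -/
def IsBdd (S : Set (Set M)) (P : Γ → Prop) : Prop :=
  ∃ (θ : BddFormula) (V : ℕ → Set M) (p : ℕ → M), (∀ i, V i ∈ insert ∅ S) ∧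
    ∀ v, P v ↔ θ.Holds V (Tuple.assign v p)

theorem IsBdd.exists_common_parameters {P R : Γ → Prop} (hP : IsBdd S P) (hR : IsBdd S R) :
    ∃ (θ η : BddFormula) (V : ℕ → Set M) (p : ℕ → M), (∀ i, V i ∈ insert ∅ S) ∧
      (∀ v, P v ↔ θ.Holds V (Tuple.assign v p)) ∧ ∀ v, R v ↔ η.Holds V (Tuple.assign v p) := by
  obtain ⟨θ, V, p, hV, hθ⟩ := hP
  obtain ⟨η, W, q, hW, hη⟩ := hR
  refine ⟨θ.subst (fun i => 2 * i) fun i => .var (Tuple.moveParams M Γ (fun k => 2 * k) i),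
    η.subst (fun i => 2 * i + 1) fun i => .var (Tuple.moveParams M Γ (fun k => 2 * k + 1) i),
    interleave V W, interleave p q, fun i => ?_, fun v => ?_, fun v => ?_⟩
  · unfold interleave
    split
    exacts [hV _, hW _]
  · simp only [BddFormula.holds_subst, NumTerm.eval, Tuple.assign_moveParams, interleave_comp_even,
      hθ]
  · simp only [BddFormula.holds_subst, NumTerm.eval, Tuple.assign_moveParams, interleave_comp_odd,
      hη]

namespace IsBdd

theorem congr {P R : Γ → Prop} (hP : IsBdd S P) (h : ∀ v, R v ↔ P v) : IsBdd S R := by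
  rwa [show R = P from funext fun v => propext (h v)]

theorem comp {P : Δ → Prop} (hP : IsBdd S P) {f : Γ → Δ} (hf : IsPoly M f := by fun_prop) :
    IsBdd S fun v => P (f v) := by
  obtain ⟨θ, V, p, hV, hθ⟩ := hP
  obtain ⟨σ, q, hσ⟩ := hf p
  refine ⟨θ.subst id σ, V, q, hV, fun v => ?_⟩
  simp only [hθ, BddFormula.holds_subst, Function.comp_id, ← hσ]

theorem eq {s t : Γ → M} (hs : IsPoly M s := by fun_prop) (ht : IsPoly M t := by fun_prop) :
    IsBdd S fun v => s v = t v := by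
  have eq_pair : IsBdd S fun w : M × M => w.1 = w.2 :=
    ⟨.eq (.var 0) (.var 1), fun _ => ∅, fun _ => 0, fun _ => .inl rfl, fun _ => Iff.rfl⟩
  exact eq_pair.comp (hs.prodMk ht)

theorem lt {s t : Γ → M} (hs : IsPoly M s := by fun_prop) (ht : IsPoly M t := by fun_prop) :
    IsBdd S fun v => s v < t v := by
  have lt_pair : IsBdd S fun w : M × M => w.1 < w.2 :=
    ⟨.lt (.var 0) (.var 1), fun _ => ∅, fun _ => 0, fun _ => .inl rfl, fun _ => Iff.rfl⟩
  exact lt_pair.comp (hs.prodMk ht)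

theorem mem {A : Set M} (hA : A ∈ S) {t : Γ → M} (ht : IsPoly M t := by fun_prop) :
    IsBdd S fun v => t v ∈ A := by
  have mem_self : IsBdd S fun a : M => a ∈ A :=
    ⟨.mem (.var 0) 0, fun _ => A, fun _ => 0, fun _ => .inr hA, fun _ => Iff.rfl⟩
  exact mem_self.comp ht

theorem not {P : Γ → Prop} (hP : IsBdd S P) : IsBdd S fun v => ¬ P v := by
  obtain ⟨θ, V, p, hV, hθ⟩ := hP
  exact ⟨.neg θ, V, p, hV, fun v => not_congr (hθ v)⟩

theorem and {P R : Γ → Prop} (hP : IsBdd S P) (hR : IsBdd S R) : IsBdd S fun v => P v ∧ R v := by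
  obtain ⟨θ, η, V, p, hV, hθ, hη⟩ := hP.exists_common_parameters hR
  exact ⟨.and θ η, V, p, hV, fun v => and_congr (hθ v) (hη v)⟩

theorem or {P R : Γ → Prop} (hP : IsBdd S P) (hR : IsBdd S R) : IsBdd S fun v => P v ∨ R v :=
  (hP.not.and hR.not).not.congr fun _ => or_iff_not_and_not

theorem imp {P R : Γ → Prop} (hP : IsBdd S P) (hR : IsBdd S R) : IsBdd S fun v => P v → R v :=
  (hP.not.or hR).congr fun _ => imp_iff_not_or

theorem iff {P R : Γ → Prop} (hP : IsBdd S P) (hR : IsBdd S R) : IsBdd S fun v => P v ↔ R v :=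
  ((hP.imp hR).and (hR.imp hP)).congr fun _ => iff_def

theorem ball {P : M → Γ → Prop} (hP : IsBdd S fun w : M × Γ => P w.1 w.2) {t : Γ → M}
    (ht : IsPoly M t := by fun_prop) : IsBdd S fun v => ∀ a < t v, P a v := by
  obtain ⟨θ, V, p, hV, hθ⟩ := hP
  have ball_fst : IsBdd S fun w : M × Γ => ∀ a < w.1, P a w.2 :=
    ⟨.ball (.var 0) (θ.subst id fun | 0 => .var 0 | n + 1 => .var (n + 2)), V, p, hV,
      fun w => forall₂_congr fun a _ => by
        rw [BddFormula.holds_subst, Function.comp_id]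
        exact (hθ (a, w.2)).trans (iff_of_eq (congrArg _ (funext fun | 0 | _ + 1 => rfl)))⟩
  exact ball_fst.comp (ht.prodMk .id)

theorem bex {P : M → Γ → Prop} (hP : IsBdd S fun w : M × Γ => P w.1 w.2) {t : Γ → M}
    (ht : IsPoly M t := by fun_prop) : IsBdd S fun v => ∃ a < t v, P a v :=
  (ball (P := fun a v => ¬ P a v) hP.not ht).not.congr fun _ => by push Not; rfl

theorem le {s t : Γ → M} (hs : IsPoly M s := by fun_prop) (ht : IsPoly M t := by fun_prop) :
    IsBdd S fun v => s v ≤ t v :=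
  (lt ht hs).not.congr fun _ => not_lt.symm

end IsBdd

end Bounded

section Sigma

variable {M : Type u} [CommSemiring M] [LinearOrder M] {S : Set (Set M)}
  {Γ Δ : Type u} [Tuple M Γ] [Tuple M Δ]

/-- `P` is defined by a `Σ⁰₁` formula with parameters from `M` and `S`. -/
def IsSigma (S : Set (Set M)) (P : Γ → Prop) : Prop :=
  ∃ R : M × Γ → Prop, IsBdd S R ∧ ∀ v, P v ↔ ∃ m, R (m, v)

/-- `P` and its negation are defined by `Σ⁰₁` formulas with parameters from `M` and `S`. -/
structure IsDelta (S : Set (Set M)) (P : Γ → Prop) : Prop where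
  pos : IsSigma S P
  neg : IsSigma S fun v => ¬ P v

theorem IsBdd.isSigma {P : Γ → Prop} (hP : IsBdd S P) : IsSigma S P :=
  ⟨fun w => P w.2, hP.comp, fun _ => ⟨fun h => ⟨0, h⟩, fun ⟨_, h⟩ => h⟩⟩

theorem IsBdd.isDelta {P : Γ → Prop} (hP : IsBdd S P) : IsDelta S P :=
  ⟨hP.isSigma, hP.not.isSigma⟩

namespace IsSigma

theorem congr {P R : Γ → Prop} (hP : IsSigma S P) (h : ∀ v, R v ↔ P v) : IsSigma S R := by
  rwa [show R = P from funext fun v => propext (h v)]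

theorem comp {P : Δ → Prop} (hP : IsSigma S P) {f : Γ → Δ} (hf : IsPoly M f := by fun_prop) :
    IsSigma S fun v => P (f v) := by
  obtain ⟨R, hR, hPR⟩ := hP
  exact ⟨fun w => R (w.1, f w.2), hR.comp, fun v => hPR (f v)⟩

theorem or {P R : Γ → Prop} (hP : IsSigma S P) (hR : IsSigma S R) :
    IsSigma S fun v => P v ∨ R v := by
  obtain ⟨P', hP', hPP'⟩ := hP
  obtain ⟨R', hR', hRR'⟩ := hR
  exact ⟨_, hP'.or hR', fun v => by simp only [hPP', hRR', exists_or]⟩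

section Quantifiers

variable [IsStrictOrderedRing M]

theorem ex {P : M → Γ → Prop} (hP : IsSigma S fun w : M × Γ => P w.1 w.2) :
    IsSigma S fun v => ∃ a, P a v := by
  obtain ⟨R, hR, hPR⟩ := hP
  refine ⟨fun w => ∃ a < w.1, ∃ m < w.1, R (m, a, w.2), .bex (.bex hR.comp), fun v => ?_⟩
  simp only [fun a => hPR (a, v)]
  refine ⟨fun ⟨a, m, h⟩ => ⟨max a m + 1, a, ?_, m, ?_, h⟩, fun ⟨_, a, _, m, _, h⟩ => ⟨a, m, h⟩⟩
  · exact (le_max_left a m).trans_lt (lt_add_one _)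
  · exact (le_max_right a m).trans_lt (lt_add_one _)

theorem and {P R : Γ → Prop} (hP : IsSigma S P) (hR : IsSigma S R) :
    IsSigma S fun v => P v ∧ R v := by
  obtain ⟨P', hP', hPP'⟩ := hP
  obtain ⟨R', hR', hRR'⟩ := hR
  have prenex : IsSigma S fun v => ∃ a b, P' (a, v) ∧ R' (b, v) := .ex <| .ex <|
    ((hP'.comp (f := fun u : M × M × Γ => (u.2.1, u.2.2))).and
      (hR'.comp (f := fun u => (u.1, u.2.2)))).isSigma
  exact prenex.congr fun v => by simp only [hPP', hRR', exists_and_left, exists_and_right]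

theorem bex {P : M → Γ → Prop} (hP : IsSigma S fun w : M × Γ => P w.1 w.2) {t : Γ → M}
    (ht : IsPoly M t := by fun_prop) : IsSigma S fun v => ∃ a < t v, P a v :=
  .ex (.and (IsBdd.lt).isSigma hP)

end Quantifiers

end IsSigma

namespace IsDelta

theorem congr {P R : Γ → Prop} (hP : IsDelta S P) (h : ∀ v, R v ↔ P v) : IsDelta S R :=
  ⟨hP.pos.congr h, hP.neg.congr fun v => not_congr (h v)⟩

theorem comp {P : Δ → Prop} (hP : IsDelta S P) {f : Γ → Δ} (hf : IsPoly M f := by fun_prop) :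
    IsDelta S fun v => P (f v) :=
  ⟨hP.pos.comp, hP.neg.comp⟩

theorem and [IsStrictOrderedRing M] {P R : Γ → Prop} (hP : IsDelta S P) (hR : IsDelta S R) :
    IsDelta S fun v => P v ∧ R v :=
  ⟨hP.pos.and hR.pos, (hP.neg.or hR.neg).congr fun _ => not_and_or⟩

end IsDelta

end Sigma

section Model

variable {M : Type u} [CommSemiring M] [LinearOrder M] [IsStrictOrderedRing M] {S : Set (Set M)}
  {Γ : Type u} [Tuple M Γ]

namespace IsModelRCA0

theorem canonicallyOrderedAdd (hM : IsModelRCA0 M S) : CanonicallyOrderedAdd M where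
  exists_add_of_le {a b} h := by
    rcases h.lt_or_eq with h | rfl
    · obtain ⟨z, hz⟩ := hM.exists_add_of_lt a b h
      exact ⟨z, hz.symm⟩
    · exact ⟨0, (add_zero a).symm⟩
  le_add_self a b := le_add_of_nonneg_left (hM.zero_le b)
  le_self_add a b := le_add_of_nonneg_right (hM.zero_le b)

/-- The discreteness of the order of a model of `RCA₀`. -/
@[reducible]
def succAddOrder (hM : IsModelRCA0 M S) : SuccAddOrder M where
  succ x := x + 1
  le_succ x := (lt_add_one x).le
  max_of_succ_le h := ((lt_add_one _).not_ge h).elim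
  succ_le_of_lt h := (hM.lt_iff_add_one_le _ _).1 h
  succ_eq_add_one _ := rfl

theorem empty_mem (hM : IsModelRCA0 M S) : ∅ ∈ S := by
  obtain ⟨A, hA⟩ := hM.sets_nonempty
  let θ : BddFormula := .lt (.var 0) (.var 0)
  have not_sigma (n : M) : ¬ SigmaHolds θ (fun _ => A) (fun _ => 0) n := fun ⟨m, hm⟩ =>
    lt_irrefl m hm
  have not_pi (n : M) : ¬ PiHolds θ (fun _ => A) (fun _ => 0) n := fun h => lt_irrefl 0 (h 0)
  rw [← Set.eq_empty_of_forall_notMem (s := {n | SigmaHolds θ _ _ n}) not_sigma]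
  exact hM.delta_comprehension θ θ _ _ (fun _ => hA) fun n => iff_of_false (not_sigma n) (not_pi n)

theorem mem_of_mem_insert_empty (hM : IsModelRCA0 M S) {A : Set M} (hA : A ∈ insert ∅ S) : A ∈ S :=
  hA.elim (fun h => h ▸ hM.empty_mem) id

theorem induction (hM : IsModelRCA0 M S) {P : M → Prop} (hP : IsSigma S P) (zero : P 0)
    (succ : ∀ n, P n → P (n + 1)) (n : M) : P n := by
  obtain ⟨R, ⟨θ, V, p, hV, hθ⟩, hPR⟩ := hP
  have sigma_iff (n : M) : P n ↔ SigmaHolds θ V p n :=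
    (hPR n).trans (exists_congr fun m => hθ (m, n))
  simp only [sigma_iff] at zero succ ⊢
  exact hM.sigma_induction θ V p (fun i => hM.mem_of_mem_insert_empty (hV i)) zero succ n

theorem comprehension (hM : IsModelRCA0 M S) {A : Set M} (hA : IsDelta S (· ∈ A)) : A ∈ S := by
  obtain ⟨⟨P, hP, hAP⟩, R, hR, hAR⟩ := hA
  obtain ⟨θ, η, V, p, hV, hθ, hη⟩ := hP.exists_common_parameters hR.not
  have sigma_iff (n : M) : n ∈ A ↔ SigmaHolds θ V p n :=
    (hAP n).trans (exists_congr fun m => hθ (m, n))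
  have pi_iff (n : M) : n ∈ A ↔ PiHolds η V p n :=
    not_not.symm.trans ((not_congr (hAR n)).trans
      (not_exists.trans (forall_congr' fun m => hη (m, n))))
  rw [show A = {n | SigmaHolds θ V p n} from Set.ext sigma_iff]
  exact hM.delta_comprehension θ η V p (fun i => hM.mem_of_mem_insert_empty (hV i)) fun n =>
    (sigma_iff n).symm.trans (pi_iff n)

end IsModelRCA0

variable [CanonicallyOrderedAdd M] [SuccAddOrder M]

theorem IsBdd.collection (hM : IsModelRCA0 M S) {R : M → M → Prop}
    (hR : IsBdd S fun w : M × M => R w.1 w.2) {k : M} (h : ∀ a < k, ∃ m, R m a) :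
    ∃ b, ∀ a < k, ∃ m < b, R m a := by
  have below (j : M) : ∃ b, ∀ a < j, a < k → ∃ m < b, R m a := by
    refine hM.induction (P := fun j => ∃ b, ∀ a < j, a < k → ∃ m < b, R m a) ?_
      ⟨0, fun a ha => (not_lt_zero ha).elim⟩ ?_ j
    · exact .ex (IsBdd.ball (.imp .lt (.bex (hR.comp (f := fun u : M × M × M × M =>
        (u.1, u.2.1)))))).isSigma
    · rintro j ⟨b, hb⟩
      by_cases hj : j < k
      · obtain ⟨m, hm⟩ := h j hj
        refine ⟨max b (m + 1), fun a ha hak => ?_⟩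
        rcases (Order.lt_add_one_iff.1 ha).lt_or_eq with ha | rfl
        · obtain ⟨m', hm', h'⟩ := hb a ha hak
          exact ⟨m', lt_max_of_lt_left hm', h'⟩
        · exact ⟨m, lt_max_of_lt_right (lt_add_one m), hm⟩
      · exact ⟨b, fun a _ hak => hb a (hak.trans_le (not_lt.1 hj)) hak⟩
  obtain ⟨b, hb⟩ := below k
  exact ⟨b, fun a ha => hb a ha ha⟩

theorem IsSigma.ball (hM : IsModelRCA0 M S) {P : M → Γ → Prop}
    (hP : IsSigma S fun w : M × Γ => P w.1 w.2) {t : Γ → M} (ht : IsPoly M t := by fun_prop) :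
    IsSigma S fun v => ∀ a < t v, P a v := by
  obtain ⟨R, hR, hPR⟩ := hP
  have collected : IsSigma S fun v => ∃ b, ∀ a < t v, ∃ m < b, R (m, a, v) :=
    .ex (IsBdd.ball (.bex (hR.comp (f := fun u : M × M × M × Γ => (u.1, u.2.1, u.2.2.2))))).isSigma
  refine collected.congr fun v => ?_
  simp only [fun a => hPR (a, v)]
  exact ⟨fun h => IsBdd.collection hM (hR.comp (f := fun w : M × M => (w.1, w.2, v))) h,
    fun ⟨b, hb⟩ a ha => (hb a ha).imp fun m hm => hm.2⟩

theorem IsDelta.bex (hM : IsModelRCA0 M S) {P : M → Γ → Prop}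
    (hP : IsDelta S fun w : M × Γ => P w.1 w.2) {t : Γ → M} (ht : IsPoly M t := by fun_prop) :
    IsDelta S fun v => ∃ a < t v, P a v :=
  ⟨hP.pos.bex, (IsSigma.ball (P := fun a v => ¬ P a v) hM hP.neg ht).congr fun _ => by
    push Not; rfl⟩

theorem IsModelRCA0.exists_least (hM : IsModelRCA0 M S) {P : M → Prop} (hP : IsDelta S P) {n : M}
    (hn : P n) : ∃ n, P n ∧ ∀ m < n, ¬ P m := by
  by_contra! no_least
  have none_below (n : M) : ∀ m < n, ¬ P m := by
    refine hM.induction (P := fun n => ∀ m < n, ¬ P m)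
      (.ball hM (hP.neg.comp (f := fun w : M × M => w.1)))
      (fun m hm => (not_lt_zero hm).elim) (fun n hn m hm hPm => ?_) n
    obtain ⟨k, hk, hPk⟩ := no_least m hPm
    exact hn k (hk.trans_le (Order.lt_add_one_iff.1 hm)) hPk
  exact none_below (n + 1) n (lt_add_one n) hn

end Model

section Arithmetic

variable {M : Type u} [CommSemiring M] [LinearOrder M]

theorem IsFinCode.ext {c d : M} (hc : IsFinCode c) (hd : IsFinCode d)
    (h : ∀ i, FinMem i c ↔ FinMem i d) : c = d := by
  rcases lt_trichotomy c d with hcd | hcd | hcd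
  · exact (hd.2 c hcd hc.1 h).elim
  · exact hcd
  · exact (hc.2 d hcd hd.1 fun i => (h i).symm).elim

variable [CanonicallyOrderedAdd M] {i j k l m n : M}

theorem left_le_pair (i j : M) : i ≤ pair i j := le_add_self

theorem FinMem.lt {c : M} (h : FinMem i c) : i < c := by
  obtain ⟨k, m, n, rfl, h, -⟩ := h
  exact h.trans_le (left_le_pair _ _)

theorem zero_mem_Pfin (A : Set M) : 0 ∈ Pfin A :=
  ⟨⟨⟨0, 0, 0, by simp [pair]⟩, fun _ h => (not_lt_zero h).elim⟩, fun _ h => (not_lt_zero h.lt).elim⟩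

variable [IsStrictOrderedRing M] [SuccAddOrder M]

theorem le_mul_of_ne_zero (hi : i ≠ 0) : j ≤ i * j :=
  le_mul_of_one_le_left zero_le (Order.one_le_iff_ne_zero.2 hi)

theorem right_le_pair (i j : M) : j ≤ pair i j := by
  rcases eq_or_ne (i + j) 0 with h | h
  · rw [(add_eq_zero.1 h).2]
    exact zero_le
  · exact le_add_self.trans ((le_mul_of_ne_zero h).trans le_self_add)

theorem pair_lt_pair (h : i + j < k + l) : pair i j < pair k l := by
  have add_one_le : i + j + 1 ≤ k + l := Order.add_one_le_of_lt h
  calc pair i j ≤ (i + j) * (i + j) + (i + j) := by unfold pair; gcongr; exact le_self_add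
    _ < (i + j) * (i + j) + (i + j) + (i + j + 1) :=
      lt_add_of_pos_right _ (zero_lt_one.trans_le le_add_self)
    _ = (i + j + 1) * (i + j + 1) := by ring
    _ ≤ (k + l) * (k + l) := mul_le_mul' add_one_le add_one_le
    _ ≤ pair k l := le_self_add

theorem pair_inj : pair i j = pair k l ↔ i = k ∧ j = l := by
  refine ⟨fun h => ?_, by rintro ⟨rfl, rfl⟩; rfl⟩
  have sum_eq : i + j = k + l := by
    rcases lt_trichotomy (i + j) (k + l) with h' | h' | h'
    · exact absurd h (pair_lt_pair h').ne
    · exact h'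
    · exact absurd h (pair_lt_pair h').ne'
  unfold pair at h
  rw [sum_eq] at h
  obtain rfl : i = k := add_left_cancel h
  exact ⟨rfl, add_left_cancel sum_eq⟩

theorem finMem_pair : FinMem i (pair k (pair m n)) ↔ i < k ∧ m * (i + 1) + 1 ∣ n := by
  refine ⟨?_, fun h => ⟨k, m, n, rfl, h⟩⟩
  rintro ⟨k', m', n', h, hi⟩
  obtain ⟨hk, h⟩ := pair_inj.1 h
  obtain ⟨hm, hn⟩ := pair_inj.1 h
  rwa [hk, hm, hn]

end Arithmetic

namespace IsBdd

section ExLe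

variable {M : Type u} [CommSemiring M] [LinearOrder M] [IsStrictOrderedRing M]
  [SuccAddOrder M] {S : Set (Set M)} {Γ : Type u} [Tuple M Γ]

theorem ex_le {P : M → Γ → Prop} (hP : IsBdd S fun w : M × Γ => P w.1 w.2) {t : Γ → M}
    (h : ∀ a v, P a v → a ≤ t v) (ht : IsPoly M t := by fun_prop) :
    IsBdd S fun v => ∃ a, P a v :=
  (bex (t := fun v => t v + 1) hP).congr fun v =>
    ⟨fun ⟨a, ha⟩ => ⟨a, Order.lt_add_one_iff.2 (h a v ha), ha⟩, fun ⟨a, _, ha⟩ => ⟨a, ha⟩⟩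

end ExLe

variable {M : Type u} [CommSemiring M] [LinearOrder M] [IsStrictOrderedRing M]
  [CanonicallyOrderedAdd M] [SuccAddOrder M] {S : Set (Set M)} {Γ : Type u} [Tuple M Γ]

theorem dvd {s t : Γ → M} (hs : IsPoly M s := by fun_prop) (ht : IsPoly M t := by fun_prop) :
    IsBdd S fun v => s v ∣ t v := by
  have bounded : IsBdd S fun v => ∃ a, t v = s v * a ∧ a ≤ t v :=
    ex_le (.and .eq .le) fun _ _ h => h.2
  refine bounded.congr fun v => ⟨?_, fun ⟨a, ha, _⟩ => ⟨a, ha⟩⟩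
  rintro ⟨a, ha⟩
  rcases eq_or_ne (s v) 0 with h | h
  · exact ⟨0, by rw [ha, h, zero_mul, zero_mul], zero_le⟩
  · exact ⟨a, ha, by rw [ha]; exact le_mul_of_ne_zero h⟩

theorem isTriple {t : Γ → M} (ht : IsPoly M t := by fun_prop) :
    IsBdd S fun v => IsTriple (t v) := by
  have isTriple_self : IsBdd S fun c : M => ∃ k m n, c = pair k (pair m n) := by
    refine ex_le (t := fun c => c) (ex_le (t := fun w => w.2)
      (ex_le (t := fun w => w.2.2) .eq ?_) ?_) ?_
    · intro n w h
      exact ((right_le_pair _ _).trans (right_le_pair _ _)).trans_eq h.symm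
    · rintro m w ⟨n, h⟩
      exact ((left_le_pair _ _).trans (right_le_pair _ _)).trans_eq h.symm
    · rintro k w ⟨m, n, h⟩
      exact (left_le_pair _ _).trans_eq h.symm
  exact isTriple_self.comp ht

theorem finMem {s t : Γ → M} (hs : IsPoly M s := by fun_prop) (ht : IsPoly M t := by fun_prop) :
    IsBdd S fun v => FinMem (s v) (t v) := by
  have finMem_fst_snd : IsBdd S fun v : M × M => ∃ k m n,
      v.2 = pair k (pair m n) ∧ v.1 < k ∧ m * (v.1 + 1) + 1 ∣ n := by
    refine ex_le (t := fun v => v.2) (ex_le (t := fun w => w.2.2)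
      (ex_le (t := fun w => w.2.2.2) (.and .eq (.and .lt .dvd)) ?_) ?_) ?_
    · rintro n w ⟨h, -⟩
      exact ((right_le_pair _ _).trans (right_le_pair _ _)).trans_eq h.symm
    · rintro m w ⟨n, h, -⟩
      exact ((left_le_pair _ _).trans (right_le_pair _ _)).trans_eq h.symm
    · rintro k w ⟨m, n, h, -⟩
      exact (left_le_pair _ _).trans_eq h.symm
  exact finMem_fst_snd.comp (hs.prodMk ht)

theorem ball_finMem {P : M → Γ → Prop} (hP : IsBdd S fun w : M × Γ => P w.1 w.2) {t : Γ → M}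
    (ht : IsPoly M t := by fun_prop) : IsBdd S fun v => ∀ i, FinMem i (t v) → P i v :=
  (ball (t := t) (.imp .finMem hP)).congr fun _ =>
    ⟨fun h i _ => h i, fun h i hi => h i hi.lt hi⟩

theorem forall_finMem_iff {P : M → Γ → Prop} (hP : IsBdd S fun w : M × Γ => P w.1 w.2)
    {t b : Γ → M} (hb : ∀ i v, P i v → i < b v) (ht : IsPoly M t := by fun_prop)
    (hb' : IsPoly M b := by fun_prop) : IsBdd S fun v => ∀ i, FinMem i (t v) ↔ P i v :=
  (ball (P := fun i v => FinMem i (t v) ↔ P i v) (t := fun v => t v + b v)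
    (.iff .finMem hP)).congr fun v =>
    ⟨fun h i _ => h i, fun h i =>
      ⟨fun hi => (h i (hi.lt.trans_le le_self_add)).1 hi,
        fun hi => (h i ((hb i v hi).trans_le le_add_self)).2 hi⟩⟩

theorem isFinCode {t : Γ → M} (ht : IsPoly M t := by fun_prop) :
    IsBdd S fun v => IsFinCode (t v) := by
  have same_set : IsBdd S fun w : M × Γ => ∀ i, FinMem i w.1 ↔ FinMem i (t w.2) :=
    forall_finMem_iff (Γ := M × Γ) (P := fun i w => FinMem i (t w.2)) (b := fun w => t w.2)
      .finMem fun _ _ h => h.lt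
  exact .and .isTriple (.ball (.imp .isTriple same_set.not))

theorem mem_Pfin {A : Set M} (hA : A ∈ S) {t : Γ → M} (ht : IsPoly M t := by fun_prop) :
    IsBdd S fun v => t v ∈ Pfin A :=
  .and .isFinCode (.ball_finMem (.mem hA))

end IsBdd

/-- `b` is invertible modulo `a`. In the absence of subtraction, the symmetric Bézout identity of
`IsCoprime` is not available. -/
def IsUnitMod {M : Type u} [CommSemiring M] (b a : M) : Prop := ∃ v w, v * b = w * a + 1

namespace IsUnitMod

section Semiring

variable {M : Type u} [CommSemiring M] {a b c : M}

theorem one (a : M) : IsUnitMod 1 a := ⟨1, 0, by simp⟩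

theorem mul (hb : IsUnitMod b a) (hc : IsUnitMod c a) : IsUnitMod (b * c) a := by
  obtain ⟨v, w, h⟩ := hb
  obtain ⟨v', w', h'⟩ := hc
  refine ⟨v * v', w * w' * a + w + w', ?_⟩
  rw [show v * v' * (b * c) = (v * b) * (v' * c) by ring, h, h']
  ring

theorem of_mul_left (h : IsUnitMod (b * c) a) : IsUnitMod b a := by
  obtain ⟨v, w, h⟩ := h
  exact ⟨v * c, w, by rw [← h]; ring⟩

theorem add_left (h : IsUnitMod b a) : IsUnitMod (a + b) a := by
  obtain ⟨v, w, h⟩ := h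
  exact ⟨v, w + v, by rw [mul_add, h]; ring⟩

end Semiring

variable {M : Type u} [CommSemiring M] [LinearOrder M] [IsStrictOrderedRing M]
  [CanonicallyOrderedAdd M] [SuccAddOrder M] {a b i j k m : M}

theorem symm (ha : a ≠ 0) (hb : b ≠ 0) (h : IsUnitMod b a) : IsUnitMod a b := by
  obtain ⟨v, w, h⟩ := h
  obtain ⟨x, hx⟩ : ∃ x, b * (w + v) = w + x :=
    exists_add_of_le (le_self_add.trans (le_mul_of_ne_zero hb))
  obtain ⟨y, hy⟩ : ∃ y, a * (w + v) = v + y :=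
    exists_add_of_le (le_add_self.trans (le_mul_of_ne_zero ha))
  refine ⟨x, y, add_left_cancel (a := w * a) ?_⟩
  calc w * a + x * a = (w + x) * a := by ring
    _ = a * (w + v) * b := by rw [← hx]; ring
    _ = v * b + y * b := by rw [hy]; ring
    _ = w * a + (y * b + 1) := by rw [h]; ring

theorem not_dvd (h : IsUnitMod b a) (ha : 1 < a) : ¬ a ∣ b := by
  rintro ⟨t, rfl⟩
  obtain ⟨v, w, h⟩ := h
  have mul_eq : a * (v * t) = a * w + 1 := by rw [mul_comm a w, ← h]; ring
  have w_lt : w < v * t := lt_of_mul_lt_mul_left (mul_eq ▸ lt_add_one (a * w)) zero_le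
  have le_mul : a * (w + 1) ≤ a * w + 1 := mul_eq ▸ mul_le_mul_right (Order.add_one_le_of_lt w_lt) a
  rw [mul_add, mul_one] at le_mul
  exact ha.not_ge (le_of_add_le_add_left le_mul)

/-- The two moduli differ by `m * (j - i)`, and `m`, hence also its divisor `j - i`, is invertible
modulo `m * (i + 1) + 1`. -/
theorem mul_add_one (hm₀ : m ≠ 0) (hm : ∀ i < k, i + 1 ∣ m) (hi : i < k) (hj : j < k)
    (hij : i ≠ j) : IsUnitMod (m * (j + 1) + 1) (m * (i + 1) + 1) := by
  wlog h : i < j generalizing i j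
  · exact (this hj hi hij.symm (hij.symm.lt_of_le (not_lt.1 h))).symm (by simp) (by simp)
  obtain ⟨d, rfl⟩ := exists_add_of_le (Order.add_one_le_of_lt h)
  have isUnitMod_m : IsUnitMod m (m * (i + 1) + 1) := by
    obtain ⟨y, hy⟩ : ∃ y, m * (i + 1) = 1 + y :=
      exists_add_of_le (Order.one_le_iff_ne_zero.2 (mul_ne_zero hm₀ (by simp)))
    refine of_mul_left (c := i + 1) ⟨m * (i + 1), y, ?_⟩
    rw [hy]
    ring
  have isUnitMod_diff : IsUnitMod (d + 1) (m * (i + 1) + 1) := by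
    obtain ⟨t, ht⟩ := hm d (le_add_self.trans_lt hj)
    rw [ht] at isUnitMod_m ⊢
    exact isUnitMod_m.of_mul_left
  rw [show m * (i + 1 + d + 1) + 1 = m * (i + 1) + 1 + m * (d + 1) by ring]
  exact (isUnitMod_m.mul isUnitMod_diff).add_left

end IsUnitMod

section FiniteSets

variable {M : Type u} [CommSemiring M] [LinearOrder M] [IsStrictOrderedRing M]
  [CanonicallyOrderedAdd M] [SuccAddOrder M] {S : Set (Set M)} {A : Set M} {j k m n : M}

theorem IsModelRCA0.exists_common_multiple (hM : IsModelRCA0 M S) (k : M) :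
    ∃ m ≠ 0, ∀ i < k, i + 1 ∣ m := by
  have bounded : IsBdd S fun w : M × M => w.1 ≠ 0 ∧ ∀ i < w.2, i + 1 ∣ w.1 :=
    .and (IsBdd.not .eq) (.ball (P := fun i (w : M × M) => i + 1 ∣ w.1) .dvd)
  refine hM.induction (P := fun k => ∃ m ≠ 0, ∀ i < k, i + 1 ∣ m) (.ex bounded.isSigma) ?_ ?_ k
  · exact ⟨1, one_ne_zero, fun i hi => (not_lt_zero hi).elim⟩
  · rintro k ⟨m, hm, h⟩
    refine ⟨m * (k + 1), mul_ne_zero hm (by simp), fun i hi => ?_⟩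
    rcases (Order.lt_add_one_iff.1 hi).lt_or_eq with hi | rfl
    · exact (h i hi).mul_right _
    · exact dvd_mul_left _ _

/-- `n` codes the part of `A` below `k` by means of the moduli `m * (i + 1) + 1`: it is divisible by
the moduli of the elements of `A` and prime to the others. -/
def IsBetaCode (A : Set M) (k m n : M) : Prop :=
  ∀ i < k, i ∈ A ∧ m * (i + 1) + 1 ∣ n ∨ i ∉ A ∧ IsUnitMod n (m * (i + 1) + 1)

theorem IsBetaCode.dvd_iff (h : IsBetaCode A k m n) (hm : m ≠ 0) {i : M} (hi : i < k) :
    m * (i + 1) + 1 ∣ n ↔ i ∈ A := by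
  rcases h i hi with ⟨hA, hdvd⟩ | ⟨hA, hunit⟩
  · exact iff_of_true hdvd hA
  · refine iff_of_false (hunit.not_dvd (lt_add_of_pos_left _ (pos_iff_ne_zero.2 ?_))) hA
    exact mul_ne_zero hm (by simp)

theorem IsBetaCode.insert (h : IsBetaCode A k m n) (hm₀ : m ≠ 0) (hm : ∀ i < k, i + 1 ∣ m)
    (hj : j < k) : IsBetaCode (insert j A) k m (n * (m * (j + 1) + 1)) := by
  intro i hi
  rcases eq_or_ne i j with rfl | hij
  · exact .inl ⟨Set.mem_insert i A, dvd_mul_left _ _⟩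
  · rcases h i hi with ⟨hA, hdvd⟩ | ⟨hA, hunit⟩
    · exact .inl ⟨Set.mem_insert_of_mem j hA, hdvd.mul_right _⟩
    · exact .inr ⟨fun h => h.elim hij hA, hunit.mul (.mul_add_one hm₀ hm hi hj hij)⟩

theorem IsModelRCA0.exists_isBetaCode (hM : IsModelRCA0 M S) (hA : A ∈ S) (hAk : ∀ i ∈ A, i < k)
    (hm₀ : m ≠ 0) (hm : ∀ i < k, i + 1 ∣ m) : ∃ n, IsBetaCode A k m n := by
  have initial_part (j : M) : ∃ n, IsBetaCode {i | i < j ∧ i ∈ A} k m n := by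
    refine hM.induction (P := fun j => ∃ n, IsBetaCode {i | i < j ∧ i ∈ A} k m n) ?_ ?_ ?_ j
    · have mem_part : IsBdd S fun u : M × M × M => u.1 < u.2.2 ∧ u.1 ∈ A := .and .lt (.mem hA)
      refine .ex (.ball hM (.or (mem_part.and .dvd).isSigma (.and mem_part.not.isSigma ?_)))
      exact .ex (.ex (IsBdd.eq).isSigma)
    · exact ⟨1, fun i _ => .inr ⟨fun h => not_lt_zero h.1, .one _⟩⟩
    · rintro j ⟨n, hn⟩
      by_cases hj : j ∈ A
      · refine ⟨n * (m * (j + 1) + 1), ?_⟩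
        convert hn.insert hm₀ hm (hAk j hj) using 1
        ext i
        simp only [Set.mem_insert_iff, Set.mem_ofPred_eq, Order.lt_add_one_iff, le_iff_lt_or_eq]
        constructor
        · rintro ⟨h | h, hi⟩
          exacts [.inr ⟨h, hi⟩, .inl h]
        · rintro (rfl | ⟨h, hi⟩)
          exacts [⟨.inr rfl, hj⟩, ⟨.inl h, hi⟩]
      · refine ⟨n, ?_⟩
        convert hn using 1
        ext i
        simp only [Set.mem_ofPred_eq, Order.lt_add_one_iff, le_iff_lt_or_eq]
        exact ⟨fun ⟨h, hi⟩ => ⟨h.resolve_right fun h => hj (h ▸ hi), hi⟩,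
          fun ⟨h, hi⟩ => ⟨.inl h, hi⟩⟩
  obtain ⟨n, hn⟩ := initial_part k
  have whole : {i | i < k ∧ i ∈ A} = A := Set.ext fun i => and_iff_right_of_imp (hAk i)
  exact ⟨n, whole ▸ hn⟩

theorem IsModelRCA0.exists_isFinCode (hM : IsModelRCA0 M S) {c : M} (hc : IsTriple c) :
    ∃ d, IsFinCode d ∧ ∀ i, FinMem i d ↔ FinMem i c := by
  have bounded : IsBdd S fun d => IsTriple d ∧ ∀ i, FinMem i d ↔ FinMem i c :=
    .and .isTriple (.forall_finMem_iff (Γ := M) (P := fun i _ => FinMem i c) (t := fun d => d)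
      (b := fun _ => c) .finMem fun _ _ h => h.lt)
  obtain ⟨d, ⟨hd, hdc⟩, least⟩ := hM.exists_least bounded.isDelta ⟨hc, fun _ => Iff.rfl⟩
  exact ⟨d, ⟨hd, fun e he he' hed => least e he ⟨he', fun i => (hed i).trans (hdc i)⟩⟩, hdc⟩

theorem IsModelRCA0.exists_code (hM : IsModelRCA0 M S) (hA : A ∈ S) (hAk : ∀ i ∈ A, i < k) :
    ∃ c, IsFinCode c ∧ ∀ i, FinMem i c ↔ i ∈ A := by
  obtain ⟨m, hm₀, hm⟩ := hM.exists_common_multiple k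
  obtain ⟨n, hn⟩ := hM.exists_isBetaCode hA hAk hm₀ hm
  obtain ⟨c, hc, mem_c⟩ := hM.exists_isFinCode ⟨k, m, n, rfl⟩
  refine ⟨c, hc, fun i => ?_⟩
  rw [mem_c, finMem_pair]
  exact ⟨fun h => (hn.dvd_iff hm₀ h.1).1 h.2, fun h => ⟨hAk i h, (hn.dvd_iff hm₀ (hAk i h)).2 h⟩⟩

theorem IsModelRCA0.exists_insert (hM : IsModelRCA0 M S) (c e : M) :
    ∃ d, ∀ i, FinMem i d ↔ i = e ∨ FinMem i c := by
  have mem_S : {i | i = e ∨ FinMem i c} ∈ S :=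
    hM.comprehension (IsBdd.or .eq .finMem).isDelta
  obtain ⟨d, -, mem_d⟩ := hM.exists_code (k := e + c + 1) mem_S fun i hi =>
    Order.lt_add_one_iff.2 (hi.elim (fun h => h ▸ le_self_add) fun h => h.lt.le.trans le_add_self)
  exact ⟨d, mem_d⟩

theorem IsModelRCA0.exists_union (hM : IsModelRCA0 M S) {c d : M} (hc : c ∈ Pfin A)
    (hd : d ∈ Pfin A) : ∃ e ∈ Pfin A, ∀ i, FinMem i e ↔ FinMem i c ∨ FinMem i d := by
  have mem_S : {i | FinMem i c ∨ FinMem i d} ∈ S :=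
    hM.comprehension (IsBdd.or .finMem .finMem).isDelta
  obtain ⟨e, he, mem_e⟩ := hM.exists_code (k := c + d) mem_S fun i hi =>
    hi.elim (fun h => h.lt.trans_le le_self_add) fun h => h.lt.trans_le le_add_self
  exact ⟨e, ⟨he, fun i hi => ((mem_e i).1 hi).elim (hc.2 i) (hd.2 i)⟩, mem_e⟩

end FiniteSets

section Functions

variable {M : Type u} [CommSemiring M]

/-- The graph of `g` as a set of coded pairs, by which functions are represented in the second-order
part of a model. -/
def graph (g : M → M) : Set M := {z | ∃ n, z = pair n (g n)}

theorem IsFun.exists_eq_graph {B f : Set M} (hf : IsFun Set.univ B f) :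
    ∃ g : M → M, f = graph g ∧ ∀ n, g n ∈ B := by
  choose g hg unique using fun n => hf.2 n trivial
  refine ⟨g, Set.ext fun z => ⟨fun hz => ?_, ?_⟩, fun n => (hg n).1⟩
  · obtain ⟨n, -, b, hb, rfl⟩ := hf.1 hz
    exact ⟨n, by rw [unique n b ⟨hb, hz⟩]⟩
  · rintro ⟨n, rfl⟩
    exact (hg n).2

variable [LinearOrder M] [IsStrictOrderedRing M] [CanonicallyOrderedAdd M] [SuccAddOrder M]
  {S : Set (Set M)} {Γ : Type u} [Tuple M Γ] {g : M → M} {a c d n x y : M}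

theorem pair_mem_graph : pair n y ∈ graph g ↔ y = g n := by
  refine ⟨?_, fun h => ⟨n, by rw [h]⟩⟩
  rintro ⟨k, h⟩
  obtain ⟨rfl, h⟩ := pair_inj.1 h
  exact h

theorem isFun_graph {B : Set M} (hg : ∀ n, g n ∈ B) : IsFun Set.univ B (graph g) := by
  refine ⟨?_, fun a _ => ⟨g a, ⟨hg a, a, rfl⟩, fun b hb => pair_mem_graph.1 hb.2⟩⟩
  rintro _ ⟨n, rfl⟩
  exact ⟨n, trivial, _, hg n, rfl⟩

theorem IsBdd.eq_app (hg : graph g ∈ S) {s t : Γ → M} (hs : IsPoly M s := by fun_prop)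
    (ht : IsPoly M t := by fun_prop) : IsBdd S fun v => s v = g (t v) :=
  (mem hg (t := fun v => pair (t v) (s v))).congr fun _ => pair_mem_graph.symm

theorem IsSigma.app {P : M → Γ → Prop} (hP : IsSigma S fun w : M × Γ => P w.1 w.2)
    (hg : graph g ∈ S) {t : Γ → M} (ht : IsPoly M t := by fun_prop) :
    IsSigma S fun v => P (g (t v)) v := by
  have eq_app : IsBdd S fun w : M × Γ => w.1 = g (t w.2) := .eq_app hg
  refine (IsSigma.ex (P := fun a v => a = g (t v) ∧ P a v) (eq_app.isSigma.and hP)).congr fun v =>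
    ⟨fun h => ⟨_, rfl, h⟩, ?_⟩
  rintro ⟨_, rfl, h⟩
  exact h

theorem IsDelta.app {P : M → Γ → Prop} (hP : IsDelta S fun w : M × Γ => P w.1 w.2)
    (hg : graph g ∈ S) {t : Γ → M} (ht : IsPoly M t := by fun_prop) :
    IsDelta S fun v => P (g (t v)) v :=
  ⟨hP.pos.app hg, IsSigma.app (P := fun a v => ¬ P a v) hP.neg hg⟩

namespace IsModelRCA0

theorem graph_mem (hM : IsModelRCA0 M S) (hg : IsSigma S fun v : M × M => v.2 = g v.1) :
    graph g ∈ S := by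
  have some_pair : IsSigma S fun z : M => ∃ n y, z = pair n y ∧ y = g n :=
    .ex <| .ex <| .and (IsBdd.eq (Γ := M × M × M)).isSigma
      (hg.comp (f := fun u : M × M × M => (u.2.1, u.1)))
  have no_pair : IsBdd S fun z : M => ∀ n < z + 1, ∀ y < z + 1, z ≠ pair n y :=
    .ball (.ball (IsBdd.not .eq))
  have other_value : IsSigma S fun z : M => ∃ n y y', (z = pair n y ∧ y ≠ y') ∧ y' = g n :=
    .ex <| .ex <| .ex <| .and (IsBdd.and .eq (.not .eq)).isSigma
      (hg.comp (f := fun u : M × M × M × M => (u.2.2.1, u.1)))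
  refine hM.comprehension ⟨some_pair.congr fun z => ?_,
    (no_pair.isSigma.or other_value).congr fun z => ⟨fun h => ?_, ?_⟩⟩
  · exact exists_congr fun n => ⟨fun h => ⟨_, h, rfl⟩, fun ⟨_, h, h'⟩ => h' ▸ h⟩
  · by_cases hz : ∃ n y, z = pair n y
    · obtain ⟨n, y, rfl⟩ := hz
      exact .inr ⟨n, y, g n, ⟨rfl, fun hy => h ⟨n, by rw [hy]⟩⟩, rfl⟩
    · push Not at hz
      exact .inl fun n _ y _ => hz n y
  · rintro (h | ⟨n, y, _, ⟨rfl, hy⟩, rfl⟩)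
    · rintro ⟨n, rfl⟩
      exact h n (Order.lt_add_one_iff.2 (left_le_pair _ _)) (g n)
        (Order.lt_add_one_iff.2 (right_le_pair _ _)) rfl
    · exact fun h => hy (pair_mem_graph.1 h)

theorem graph_comp_mem (hM : IsModelRCA0 M S) {f : M → M} (hf : graph f ∈ S) (hg : graph g ∈ S) :
    graph (g ∘ f) ∈ S := by
  have eq_app : IsBdd S fun w : M × M × M => w.2.2 = g w.1 := .eq_app hg
  exact hM.graph_mem (.app (P := fun a (v : M × M) => v.2 = g a) eq_app.isSigma hf)

theorem exists_bdd_choice (hM : IsModelRCA0 M S) {R : M → M → Prop}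
    (hR : IsBdd S fun v : M × M => R v.1 v.2) (total : ∀ n, ∃ y, R n y) :
    ∃ g : M → M, graph g ∈ S ∧ ∀ n, R n (g n) := by
  have exists_least (n : M) : ∃ y, R n y ∧ ∀ z < y, ¬ R n z := by
    obtain ⟨y, hy⟩ := total n
    exact hM.exists_least (hR.comp (f := fun y : M => (n, y))).isDelta hy
  choose g hg least using exists_least
  have least_value : IsBdd S fun v : M × M => R v.1 v.2 ∧ ∀ z < v.2, ¬ R v.1 z :=
    hR.and (.ball (hR.comp (f := fun u : M × M × M => (u.2.1, u.1))).not)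
  refine ⟨g, hM.graph_mem (least_value.isSigma.congr fun v => ⟨fun h => ?_, fun ⟨h, h'⟩ => ?_⟩), hg⟩
  · rw [h]
    exact ⟨hg v.1, least v.1⟩
  · exact le_antisymm (not_lt.1 fun hlt => h' _ hlt (hg _)) (not_lt.1 fun hlt => least _ _ hlt h)

theorem exists_choice (hM : IsModelRCA0 M S) {P : M → M → Prop}
    (hP : IsSigma S fun v : M × M => P v.1 v.2) (total : ∀ n, ∃ y, P n y) :
    ∃ g : M → M, graph g ∈ S ∧ ∀ n, P n (g n) := by
  obtain ⟨R, hR, hPR⟩ := hP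
  have witnessed : IsBdd S fun v : M × M => ∃ y w, v.2 = pair y w ∧ R (w, v.1, y) := by
    refine .ex_le (t := fun v => v.2) (.ex_le (t := fun w => w.2.2) (.and .eq
      (hR.comp (f := fun u : M × M × M × M => (u.1, u.2.2.1, u.2.1)))) ?_) ?_
    · rintro w v ⟨h, -⟩
      exact (right_le_pair _ _).trans_eq h.symm
    · rintro y v ⟨w, h, -⟩
      exact (left_le_pair _ _).trans_eq h.symm
  obtain ⟨z, hz, hzR⟩ := hM.exists_bdd_choice (R := fun n z => ∃ y w, z = pair y w ∧ R (w, n, y))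
    witnessed fun n => by
      obtain ⟨y, hy⟩ := total n
      obtain ⟨w, hw⟩ := (hPR (n, y)).1 hy
      exact ⟨_, y, w, rfl, hw⟩
  choose g w hg hgR using hzR
  have first_component : IsSigma S fun v : M × M => ∃ w, pair v.2 w = z v.1 :=
    .ex (IsBdd.eq_app hz).isSigma
  refine ⟨g, hM.graph_mem (first_component.congr fun v => ?_), fun n => (hPR (n, g n)).2 ⟨_, hgR n⟩⟩
  simp only [hg, pair_inj, exists_and_left, exists_eq, and_true]

end IsModelRCA0

/-- `c` codes a set of pairs `(n, y)` that witness the values `y` at `n` of the sequence with first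
term `a` and step `g`: every pair is `(0, a)` or results from another one by a step. -/
def IsTrace (g : M → M) (a c : M) : Prop :=
  ∀ z, FinMem z c → z = pair 0 a ∨ ∃ i y, FinMem (pair i y) c ∧ z = pair (i + 1) (g y)

theorem IsSigma.isTrace (hM : IsModelRCA0 M S) (hg : graph g ∈ S) (a : M) {t : Γ → M}
    (ht : IsPoly M t := by fun_prop) : IsSigma S fun v => IsTrace g a (t v) := by
  have step : IsSigma S fun w : M × M => ∃ i y, FinMem (pair i y) w.2 ∧ w.1 = pair (i + 1) (g y) :=
    .ex <| .ex <| .and (IsBdd.finMem (Γ := M × M × M × M)).isSigma <|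
      .app (P := fun x u => u.2.2.1 = pair (u.2.1 + 1) x)
        (IsBdd.eq (Γ := M × M × M × M × M)).isSigma hg
  have bounded : IsSigma S fun c : M => ∀ z < c, ¬ FinMem z c ∨ z = pair 0 a ∨
      ∃ i y, FinMem (pair i y) c ∧ z = pair (i + 1) (g y) :=
    .ball hM (.or (IsBdd.finMem (Γ := M × M)).not.isSigma
      (.or (IsBdd.eq (Γ := M × M)).isSigma step))
  refine (bounded.comp ht).congr fun v => ⟨fun h z _ => ?_, fun h z hz => ?_⟩
  · exact or_iff_not_imp_left.2 fun hz => h z (not_not.1 hz)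
  · exact (h z hz.lt).resolve_left (not_not.2 hz)

namespace IsTrace

theorem eq_of_finMem_zero (hc : IsTrace g a c) (h : FinMem (pair 0 y) c) : y = a := by
  rcases hc _ h with h' | ⟨i, x, -, h'⟩
  · exact (pair_inj.1 h').2
  · exact absurd (pair_inj.1 h').1.symm (by simp)

theorem exists_of_finMem_add_one (hc : IsTrace g a c) (h : FinMem (pair (n + 1) y) c) :
    ∃ x, FinMem (pair n x) c ∧ y = g x := by
  rcases hc _ h with h' | ⟨i, x, hx, h'⟩
  · exact absurd (pair_inj.1 h').1 (by simp)
  · obtain ⟨h₁, h₂⟩ := pair_inj.1 h'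
    rw [add_right_cancel h₁, h₂]
    exact ⟨x, hx, rfl⟩

theorem unique (hM : IsModelRCA0 M S) (hc : IsTrace g a c) (hd : IsTrace g a d) (n : M) :
    ∀ x y, FinMem (pair n x) c → FinMem (pair n y) d → x = y := by
  have bounded (n : M) : ∀ x < c, ∀ y < d, FinMem (pair n x) c → FinMem (pair n y) d → x = y := by
    refine hM.induction (P := fun n => ∀ x < c, ∀ y < d, FinMem (pair n x) c →
      FinMem (pair n y) d → x = y) ?_ ?_ ?_ n
    · exact (IsBdd.ball (.ball (.imp .finMem (.imp .finMem .eq)))).isSigma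
    · intro x _ y _ hx hy
      rw [hc.eq_of_finMem_zero hx, hd.eq_of_finMem_zero hy]
    · intro n ih x _ y _ hx hy
      obtain ⟨x', hx', rfl⟩ := hc.exists_of_finMem_add_one hx
      obtain ⟨y', hy', rfl⟩ := hd.exists_of_finMem_add_one hy
      rw [ih x' ((right_le_pair _ _).trans_lt hx'.lt) y' ((right_le_pair _ _).trans_lt hy'.lt)
        hx' hy']
  exact fun x y hx hy => bounded n x ((right_le_pair _ _).trans_lt hx.lt) y
    ((right_le_pair _ _).trans_lt hy.lt) hx hy

theorem exists_start (hM : IsModelRCA0 M S) (g : M → M) (a : M) :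
    ∃ c, IsTrace g a c ∧ FinMem (pair 0 a) c := by
  obtain ⟨c, hc⟩ := hM.exists_insert 0 (pair 0 a)
  exact ⟨c, fun z hz => .inl (((hc z).1 hz).resolve_right fun h => not_lt_zero h.lt),
    (hc _).2 (.inl rfl)⟩

theorem exists_step (hM : IsModelRCA0 M S) (hc : IsTrace g a c) (h : FinMem (pair n y) c) :
    ∃ d, IsTrace g a d ∧ FinMem (pair (n + 1) (g y)) d := by
  obtain ⟨d, hd⟩ := hM.exists_insert c (pair (n + 1) (g y))
  refine ⟨d, fun z hz => ?_, (hd _).2 (.inl rfl)⟩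
  rcases (hd z).1 hz with rfl | hz
  · exact .inr ⟨n, y, (hd _).2 (.inr h), rfl⟩
  · exact (hc z hz).imp_right fun ⟨i, x, hx, hzx⟩ => ⟨i, x, (hd _).2 (.inr hx), hzx⟩

end IsTrace

namespace IsModelRCA0

theorem exists_iterate (hM : IsModelRCA0 M S) (hg : graph g ∈ S) (a : M) :
    ∃ f : M → M, graph f ∈ S ∧ f 0 = a ∧ ∀ n, f (n + 1) = g (f n) := by
  have value : IsSigma S fun v : M × M => ∃ c, IsTrace g a c ∧ FinMem (pair v.1 v.2) c :=
    .ex (.and (.isTrace hM hg a) (IsBdd.finMem (Γ := M × M × M)).isSigma)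
  have total (n : M) : ∃ y c, IsTrace g a c ∧ FinMem (pair n y) c := by
    refine hM.induction (P := fun n => ∃ y c, IsTrace g a c ∧ FinMem (pair n y) c) ?_ ?_ ?_ n
    · exact .ex (value.comp (f := fun w : M × M => (w.2, w.1)))
    · exact ⟨a, IsTrace.exists_start hM g a⟩
    · rintro n ⟨y, c, hc, h⟩
      exact ⟨g y, hc.exists_step hM h⟩
  obtain ⟨f, hf, hfc⟩ := hM.exists_choice value total
  refine ⟨f, hf, ?_, fun n => ?_⟩
  · obtain ⟨c, hc, h⟩ := hfc 0
    exact hc.eq_of_finMem_zero h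
  · obtain ⟨c, hc, h⟩ := hfc n
    obtain ⟨d, hd, h⟩ := hc.exists_step hM h
    obtain ⟨e, he, h'⟩ := hfc (n + 1)
    exact he.unique hM hd (n + 1) _ _ h' h

theorem monotone_of_le_add_one (hM : IsModelRCA0 M S) (hg : graph g ∈ S)
    (h : ∀ n, g n ≤ g (n + 1)) : Monotone g := by
  intro m n hmn
  obtain ⟨d, rfl⟩ := exists_add_of_le hmn
  refine hM.induction (P := fun d => g m ≤ g (m + d)) ?_ (by rw [add_zero]) (fun d ih => ?_) d
  · exact .app (P := fun y _ => g m ≤ y) (t := fun d => m + d) (IsBdd.le (Γ := M × M)).isSigma hg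
  · rw [← add_assoc]
    exact ih.trans (h _)

end IsModelRCA0

end Functions

section Spaces

variable {M : Type u} [CommSemiring M] [LinearOrder M] [IsStrictOrderedRing M]
  [CanonicallyOrderedAdd M] [SuccAddOrder M] {S : Set (Set M)} {D : CSC M}

theorem CSC.memAt_graph {H : M → M} {x n : M} :
    D.MemAt (graph H) x n ↔ ∃ i, FinMem i (H n) ∧ pair x i ∈ D.U := by
  simp only [CSC.MemAt, pair_mem_graph]
  exact ⟨fun ⟨_, i, h, h'⟩ => ⟨i, h ▸ h'⟩, fun ⟨i, h⟩ => ⟨_, i, rfl, h⟩⟩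

theorem IsDelta.memAt {Γ : Type u} [Tuple M Γ] (hU : D.U ∈ S) {h : Set M} (hh : D.IsOpenCode S h)
    {s t : Γ → M} (hs : IsPoly M s := by fun_prop) (ht : IsPoly M t := by fun_prop) :
    IsDelta S fun v => D.MemAt h (s v) (t v) := by
  obtain ⟨hS, hf⟩ := hh
  obtain ⟨H, rfl, -⟩ := hf.exists_eq_graph
  have bounded : IsBdd S fun w : M × Γ => ∃ i, FinMem i w.1 ∧ pair (s w.2) i ∈ D.U :=
    .ex_le (t := fun w => w.1) (.and .finMem (.mem hU)) fun _ _ h => h.1.lt.le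
  exact (IsDelta.app (P := fun c v => ∃ i, FinMem i c ∧ pair (s v) i ∈ D.U) bounded.isDelta
    hS).congr fun v => CSC.memAt_graph

theorem pair_mem_prodSet {A B : Set M} {a b : M} : pair a b ∈ prodSet A B ↔ a ∈ A ∧ b ∈ B := by
  refine ⟨?_, fun h => ⟨a, h.1, b, h.2, rfl⟩⟩
  rintro ⟨a', ha, b', hb, h⟩
  obtain ⟨rfl, rfl⟩ := pair_inj.1 h
  exact ⟨ha, hb⟩

theorem IsModelRCA0.exists_finite_sections (hM : IsModelRCA0 M S) {A : Set M} (hA : A ∈ S)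
    {R : M → M → Prop} (hR : IsDelta S fun v : M × M => R v.1 v.2)
    (hRA : ∀ n q, R n q → q ∈ A) (hRn : ∀ n q, R n q → q ≤ n) :
    ∃ H : M → M, graph H ∈ S ∧ (∀ n, H n ∈ Pfin A) ∧ ∀ n q, FinMem q (H n) ↔ R n q := by
  have code (n : M) : ∃ c ∈ Pfin A, ∀ q, FinMem q c ↔ R n q := by
    have section_mem : {q | R n q} ∈ S := hM.comprehension (hR.comp (f := fun q : M => (n, q)))
    obtain ⟨c, hc, hcR⟩ := hM.exists_code (k := n + 1) section_mem fun q hq =>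
      Order.lt_add_one_iff.2 (hRn n q hq)
    exact ⟨c, ⟨hc, fun q hq => hRA n q ((hcR q).1 hq)⟩, hcR⟩
  have agree : IsSigma S fun w : M × M × M => FinMem w.1 w.2.2 ↔ R w.2.1 w.1 := by
    have finMem : IsDelta S fun w : M × M × M => FinMem w.1 w.2.2 := (IsBdd.finMem).isDelta
    have rel : IsDelta S fun w : M × M × M => R w.2.1 w.1 :=
      hR.comp (f := fun w : M × M × M => (w.2.1, w.1))
    exact ((finMem.pos.and rel.pos).or (finMem.neg.and rel.neg)).congr fun _ =>
      iff_iff_and_or_not_and_not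
  have bounded : IsSigma S fun v : M × M =>
      v.2 ∈ Pfin A ∧ ∀ q < v.1 + v.2 + 1, FinMem q v.2 ↔ R v.1 q :=
    .and (IsBdd.mem_Pfin hA).isSigma
      (.ball (P := fun q (v : M × M) => FinMem q v.2 ↔ R v.1 q) hM agree)
  obtain ⟨H, hH, hHR⟩ := hM.exists_choice
    (P := fun n c => c ∈ Pfin A ∧ ∀ q < n + c + 1, FinMem q c ↔ R n q) bounded fun n =>
      (code n).imp fun c hc => ⟨hc.1, fun q _ => hc.2 q⟩
  refine ⟨H, hH, fun n => (hHR n).1, fun n q => ?_⟩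
  by_cases hq : q < n + H n + 1
  · exact (hHR n).2 q hq
  · rw [Order.lt_add_one_iff] at hq
    exact iff_of_false (fun h => hq (h.lt.le.trans le_add_self)) fun h =>
      hq ((hRn n q h).trans le_self_add)

end Spaces

section QuasiOrder

variable {M : Type u} [CommSemiring M] [LinearOrder M] [IsStrictOrderedRing M]
  [CanonicallyOrderedAdd M] [SuccAddOrder M] {S : Set (Set M)} {Q L h : Set M} {c n q x y : M}

theorem IsQuasiOrder.left_mem (hQ : IsQuasiOrder S Q L) (h : pair x y ∈ L) : x ∈ Q :=
  (pair_mem_prodSet.1 (hQ.rel_subset h)).1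

theorem IsQuasiOrder.right_mem (hQ : IsQuasiOrder S Q L) (h : pair x y ∈ L) : y ∈ Q :=
  (pair_mem_prodSet.1 (hQ.rel_subset h)).2

theorem IsQuasiOrder.pair_mem_trans (hQ : IsQuasiOrder S Q L) (hqx : pair q x ∈ L)
    (hxy : pair x y ∈ L) : pair q y ∈ L :=
  hQ.trans q (hQ.left_mem hqx) x (hQ.right_mem hqx) y (hQ.right_mem hxy) hqx hxy

theorem pair_mem_alex_U (hQ : IsQuasiOrder S Q L) : pair x q ∈ (alex Q L).U ↔ pair q x ∈ L := by
  refine ⟨?_, fun h => ⟨x, hQ.right_mem h, q, hQ.left_mem h, rfl, h⟩⟩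
  rintro ⟨x', -, q', -, h, h'⟩
  obtain ⟨rfl, rfl⟩ := pair_inj.1 h
  exact h'

theorem pair_mem_upper_U :
    pair x c ∈ (upper Q L).U ↔ x ∈ Q ∧ c ∈ Pfin Q ∧ ∀ p, FinMem p c → pair x p ∉ L := by
  refine ⟨?_, fun ⟨hx, hc, h⟩ => ⟨x, hx, c, hc, rfl, h⟩⟩
  rintro ⟨x', hx, c', hc, h, h'⟩
  obtain ⟨rfl, rfl⟩ := pair_inj.1 h
  exact ⟨hx, hc, h'⟩

theorem alex_U_mem (hM : IsModelRCA0 M S) (hQ : IsQuasiOrder S Q L) : (alex Q L).U ∈ S := by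
  have bounded : IsBdd S fun z : M => ∃ x, x ∈ Q ∧ ∃ q, q ∈ Q ∧ z = pair x q ∧ pair q x ∈ L := by
    refine .ex_le (t := fun z => z) (.and (.mem hQ.carrier_mem) (.ex_le (t := fun w => w.2)
      (.and (.mem hQ.carrier_mem) (.and .eq (.mem hQ.rel_mem))) ?_)) ?_
    · rintro q v ⟨-, h, -⟩
      exact (right_le_pair _ _).trans_eq h.symm
    · rintro x v ⟨-, q, -, h, -⟩
      exact (left_le_pair _ _).trans_eq h.symm
  exact hM.comprehension bounded.isDelta

theorem alex_k_mem (hM : IsModelRCA0 M S) (hQ : Q ∈ S) : (alex Q L).k ∈ S := by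
  have bounded : IsBdd S fun z : M =>
      ∃ q, q ∈ Q ∧ ∃ p, p ∈ Q ∧ ∃ r, r ∈ Q ∧ z = pair (pair q (pair p r)) q := by
    refine .ex_le (t := fun z => z) (.and (.mem hQ) (.ex_le (t := fun w => w.2) (.and (.mem hQ)
      (.ex_le (t := fun w => w.2.2) (.and (.mem hQ) .eq) ?_)) ?_)) ?_
    · rintro r v ⟨-, h⟩
      exact ((right_le_pair _ _).trans ((right_le_pair _ _).trans (left_le_pair _ _))).trans_eq
        h.symm
    · rintro p v ⟨-, r, -, h⟩
      exact ((left_le_pair _ _).trans ((right_le_pair _ _).trans (left_le_pair _ _))).trans_eq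
        h.symm
    · rintro q v ⟨-, p, -, r, -, h⟩
      exact (right_le_pair _ _).trans_eq h.symm
  exact hM.comprehension bounded.isDelta

theorem alex_k_isFun (Q L : Set M) :
    IsFun (prodSet (alex Q L).X (prodSet (alex Q L).I (alex Q L).I)) (alex Q L).I (alex Q L).k := by
  constructor
  · rintro _ ⟨q, hq, p, hp, r, hr, rfl⟩
    exact ⟨_, ⟨q, hq, _, ⟨p, hp, r, hr, rfl⟩, rfl⟩, q, hq, rfl⟩
  · rintro _ ⟨q, hq, _, ⟨p, hp, r, hr, rfl⟩, rfl⟩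
    refine ⟨q, ⟨hq, q, hq, p, hp, r, hr, rfl⟩, ?_⟩
    rintro l ⟨-, q', -, p', -, r', -, h⟩
    obtain ⟨h₁, rfl⟩ := pair_inj.1 h
    exact (pair_inj.1 h₁).1.symm

theorem alex_isSpace (hM : IsModelRCA0 M S) (hQ : IsQuasiOrder S Q L) : (alex Q L).IsSpace S where
  X_mem := hQ.carrier_mem
  I_mem := hQ.carrier_mem
  U_mem := alex_U_mem hM hQ
  k_mem := alex_k_mem hM hQ.carrier_mem
  U_subset := by
    rintro _ ⟨x, hx, q, hq, rfl, -⟩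
    exact ⟨x, hx, q, hq, rfl⟩
  k_fun := alex_k_isFun Q L
  cover x hx := ⟨x, hx, (pair_mem_alex_U hQ).2 (hQ.refl x hx)⟩
  inter := by
    rintro x hx i - j - l - hxi hxj ⟨q, -, p, -, r, -, h⟩
    obtain ⟨h₁, rfl⟩ := pair_inj.1 h
    obtain ⟨rfl, -⟩ := pair_inj.1 h₁
    simp only [pair_mem_alex_U hQ] at hxi hxj ⊢
    exact ⟨hQ.refl x hx, fun y hy => ⟨hQ.pair_mem_trans hxi hy, hQ.pair_mem_trans hxj hy⟩⟩

theorem upper_U_mem (hM : IsModelRCA0 M S) (hQ : IsQuasiOrder S Q L) : (upper Q L).U ∈ S := by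
  have bounded : IsBdd S fun z : M => ∃ x, x ∈ Q ∧ ∃ c, c ∈ Pfin Q ∧ z = pair x c ∧
      ∀ p, FinMem p c → pair x p ∉ L := by
    refine .ex_le (t := fun z => z) (.and (.mem hQ.carrier_mem) (.ex_le (t := fun w => w.2)
      (.and (.mem_Pfin hQ.carrier_mem) (.and .eq (.ball_finMem
        (IsBdd.mem hQ.rel_mem (t := fun u : M × M × M × M => pair u.2.2.1 u.1)).not))) ?_)) ?_
    · rintro q v ⟨-, h, -⟩
      exact (right_le_pair _ _).trans_eq h.symm
    · rintro x v ⟨-, q, -, h, -⟩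
      exact (left_le_pair _ _).trans_eq h.symm
  exact hM.comprehension bounded.isDelta

theorem upper_k_mem (hM : IsModelRCA0 M S) (hQ : Q ∈ S) : (upper Q L).k ∈ S := by
  have union : IsBdd S fun w : M × M × M × M × M =>
      ∀ i, FinMem i w.1 ↔ FinMem i w.2.2.1 ∨ FinMem i w.2.1 :=
    .forall_finMem_iff (P := fun i (w : M × M × M × M × M) => FinMem i w.2.2.1 ∨ FinMem i w.2.1)
      (b := fun w => w.2.2.1 + w.2.1) (.or .finMem .finMem) fun i w h =>
      h.elim (fun h => h.lt.trans_le le_self_add) fun h => h.lt.trans_le le_add_self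
  have bounded : IsBdd S fun z : M => ∃ q, q ∈ Q ∧ ∃ c, c ∈ Pfin Q ∧ ∃ d, d ∈ Pfin Q ∧
      ∃ e, e ∈ Pfin Q ∧ z = pair (pair q (pair c d)) e ∧
        ∀ i, FinMem i e ↔ FinMem i c ∨ FinMem i d := by
    refine .ex_le (t := fun z => z) (.and (.mem hQ) (.ex_le (t := fun w => w.2) (.and (.mem_Pfin hQ)
      (.ex_le (t := fun w => w.2.2) (.and (.mem_Pfin hQ) (.ex_le (t := fun w => w.2.2.2)
        (.and (.mem_Pfin hQ) (.and .eq union)) ?_)) ?_)) ?_)) ?_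
    · rintro e v ⟨-, h, -⟩
      exact (right_le_pair _ _).trans_eq h.symm
    · rintro d v ⟨-, e, -, h, -⟩
      exact ((right_le_pair _ _).trans ((right_le_pair _ _).trans (left_le_pair _ _))).trans_eq
        h.symm
    · rintro c v ⟨-, d, -, e, -, h, -⟩
      exact ((left_le_pair _ _).trans ((right_le_pair _ _).trans (left_le_pair _ _))).trans_eq
        h.symm
    · rintro q v ⟨-, c, -, d, -, e, -, h, -⟩
      exact ((left_le_pair _ _).trans (left_le_pair _ _)).trans_eq h.symm
  exact hM.comprehension bounded.isDelta

theorem upper_k_isFun (hM : IsModelRCA0 M S) (Q L : Set M) :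
    IsFun (prodSet (upper Q L).X (prodSet (upper Q L).I (upper Q L).I)) (upper Q L).I
      (upper Q L).k := by
  constructor
  · rintro _ ⟨q, hq, c, hc, d, hd, e, he, rfl, -⟩
    exact ⟨_, ⟨q, hq, _, ⟨c, hc, d, hd, rfl⟩, rfl⟩, e, he, rfl⟩
  · rintro _ ⟨q, hq, _, ⟨c, hc, d, hd, rfl⟩, rfl⟩
    obtain ⟨e, he, h⟩ := hM.exists_union hc hd
    refine ⟨e, ⟨he, q, hq, c, hc, d, hd, e, he, rfl, h⟩, ?_⟩
    rintro l ⟨-, q', -, c', -, d', -, e', he', heq, h'⟩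
    obtain ⟨h₁, rfl⟩ := pair_inj.1 heq
    obtain ⟨rfl, h₂⟩ := pair_inj.1 h₁
    obtain ⟨rfl, rfl⟩ := pair_inj.1 h₂
    exact he'.1.ext he.1 fun i => (h' i).trans (h i).symm

theorem upper_isSpace (hM : IsModelRCA0 M S) (hQ : IsQuasiOrder S Q L) : (upper Q L).IsSpace S where
  X_mem := hQ.carrier_mem
  I_mem := hM.comprehension (IsBdd.mem_Pfin (t := fun c => c) hQ.carrier_mem).isDelta
  U_mem := upper_U_mem hM hQ
  k_mem := upper_k_mem hM hQ.carrier_mem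
  U_subset := by
    rintro _ ⟨x, hx, c, hc, rfl, -⟩
    exact ⟨x, hx, c, hc, rfl⟩
  k_fun := upper_k_isFun hM Q L
  cover x hx := ⟨0, zero_mem_Pfin Q, pair_mem_upper_U.2
    ⟨hx, zero_mem_Pfin Q, fun _ h => (not_lt_zero h.lt).elim⟩⟩
  inter := by
    rintro x hx c hc d hd e he hxc hxd ⟨q', -, c', -, d', -, e', -, heq, h⟩
    obtain ⟨h₁, rfl⟩ := pair_inj.1 heq
    obtain ⟨rfl, h₂⟩ := pair_inj.1 h₁
    obtain ⟨rfl, rfl⟩ := pair_inj.1 h₂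
    simp only [pair_mem_upper_U] at hxc hxd ⊢
    exact ⟨⟨hx, he, fun p hp => ((h p).1 hp).elim (hxc.2.2 p) (hxd.2.2 p)⟩, fun y hy =>
      ⟨⟨hy.1, hc, fun p hp => hy.2.2 p ((h p).2 (.inl hp))⟩,
        hy.1, hd, fun p hp => hy.2.2 p ((h p).2 (.inr hp))⟩⟩

theorem alex_memAt_mono (hQ : IsQuasiOrder S Q L) (hx : (alex Q L).MemAt h x n)
    (hxy : pair x y ∈ L) : (alex Q L).MemAt h y n := by
  obtain ⟨c, q, hc, hq, hqx⟩ := hx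
  exact ⟨c, q, hc, hq,
    (pair_mem_alex_U hQ).2 (hQ.pair_mem_trans ((pair_mem_alex_U hQ).1 hqx) hxy)⟩

theorem upper_memAt_mono (hQ : IsQuasiOrder S Q L) (hx : (upper Q L).MemAt h x n)
    (hxy : pair x y ∈ L) : (upper Q L).MemAt h y n := by
  obtain ⟨c, d, hc, hd, hxd⟩ := hx
  obtain ⟨-, hdQ, hxd⟩ := pair_mem_upper_U.1 hxd
  exact ⟨c, d, hc, hd, pair_mem_upper_U.2 ⟨hQ.right_mem hxy, hdQ, fun p hp hyp =>
    hxd p hp (hQ.pair_mem_trans hxy hyp)⟩⟩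

/-- The stage `pair m q` contributes `q` alone, which keeps the stages finite. -/
theorem exists_isOpenCode_alex (hM : IsModelRCA0 M S) (hQ : IsQuasiOrder S Q L) {A : M → M → Prop}
    (hA : IsDelta S fun v : M × M => A v.1 v.2) (hAQ : ∀ m q, A m q → q ∈ Q) :
    ∃ h, (alex Q L).IsOpenCode S h ∧
      ∀ x n, (alex Q L).MemAt h x n ↔ ∃ m q, n = pair m q ∧ A m q ∧ pair q x ∈ L := by
  have eq_pair : IsBdd S fun w : M × M × M => w.2.1 = pair w.1 w.2.2 := .eq
  have stage : IsDelta S fun v : M × M => ∃ m < v.1 + 1, v.1 = pair m v.2 ∧ A m v.2 :=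
    .bex (P := fun m (v : M × M) => v.1 = pair m v.2 ∧ A m v.2) hM
      (eq_pair.isDelta.and (hA.comp (f := fun w : M × M × M => (w.1, w.2.2))))
  obtain ⟨H, hH, hHQ, mem_H⟩ := hM.exists_finite_sections hQ.carrier_mem
    (R := fun n q => ∃ m < n + 1, n = pair m q ∧ A m q) stage
    (fun n q ⟨m, _, _, hq⟩ => hAQ m q hq)
    (fun n q ⟨m, _, hn, _⟩ => (right_le_pair m q).trans_eq hn.symm)
  refine ⟨graph H, ⟨hH, isFun_graph hHQ⟩, fun x n => CSC.memAt_graph.trans ?_⟩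
  simp only [mem_H, pair_mem_alex_U hQ]
  constructor
  · rintro ⟨q, ⟨m, -, hn, hq⟩, hqx⟩
    exact ⟨m, q, hn, hq, hqx⟩
  · rintro ⟨m, q, rfl, hq, hqx⟩
    exact ⟨q, ⟨m, Order.lt_add_one_iff.2 (left_le_pair m q), rfl, hq⟩, hqx⟩

theorem exists_isOpenCode_alex_of_upper (hM : IsModelRCA0 M S) (hQ : IsQuasiOrder S Q L)
    (hh : (upper Q L).IsOpenCode S h) :
    ∃ h', (alex Q L).IsOpenCode S h' ∧
      (∀ x n, (alex Q L).MemAt h' x n → ∃ m ≤ n, (upper Q L).MemAt h x m) ∧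
      ∀ x, (upper Q L).MemOpen h x → (alex Q L).MemOpen h' x := by
  have mem_carrier (x m : M) (hx : (upper Q L).MemAt h x m) : x ∈ Q := by
    obtain ⟨_, _, -, -, hU⟩ := hx
    exact (pair_mem_upper_U.1 hU).1
  obtain ⟨h', hh', memAt_h'⟩ := exists_isOpenCode_alex hM hQ
    (A := fun m q => (upper Q L).MemAt h q m) (.memAt (upper_U_mem hM hQ) hh)
    fun m q => mem_carrier q m
  refine ⟨h', hh', fun x n hx => ?_, fun x ⟨m, hx⟩ => ?_⟩
  · obtain ⟨m, q, rfl, hq, hqx⟩ := (memAt_h' x n).1 hx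
    exact ⟨m, left_le_pair m q, upper_memAt_mono hQ hq hqx⟩
  · exact ⟨pair m x, (memAt_h' x _).2 ⟨m, x, rfl, hx, hQ.refl x (mem_carrier x m hx)⟩⟩

theorem upper_isNoetherian (hM : IsModelRCA0 M S) (hQ : IsQuasiOrder S Q L)
    (alex_noetherian : (alex Q L).IsNoetherian S) : (upper Q L).IsNoetherian S := by
  refine ⟨upper_isSpace hM hQ, fun h hh f hf subset => ?_⟩
  obtain ⟨h', hh', of_h', to_h'⟩ := exists_isOpenCode_alex_of_upper hM hQ hh
  obtain ⟨f', hf', of_f', to_f'⟩ := exists_isOpenCode_alex_of_upper hM hQ hf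
  obtain ⟨N, hN⟩ := alex_noetherian.2 h' hh' f' hf' fun x ⟨n, hx⟩ =>
    to_f' x (subset x ((of_h' x n hx).imp fun _ hm => hm.2))
  refine ⟨N, fun x hx => ?_⟩
  obtain ⟨n, hn, hxn⟩ := hN x (to_h' x hx)
  obtain ⟨m, hm, hxm⟩ := of_f' x n hxn
  exact ⟨m, hm.trans_lt hn, hxm⟩

theorem isWQO_of_alex_isNoetherian (hM : IsModelRCA0 M S) (hQ : IsQuasiOrder S Q L)
    (alex_noetherian : (alex Q L).IsNoetherian S) : IsWQO S Q L := by
  refine ⟨hQ, fun f hf isFun_f => ?_⟩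
  obtain ⟨g, rfl, hg⟩ := isFun_f.exists_eq_graph
  have eq_app : IsBdd S fun v : M × M => v.2 = g v.1 := .eq_app hf
  obtain ⟨h, hh, memAt_h⟩ := exists_isOpenCode_alex hM hQ (A := fun m q => q = g m)
    eq_app.isDelta fun m q hq => hq ▸ hg m
  obtain ⟨N, hN⟩ := alex_noetherian.2 h hh h hh fun _ => id
  obtain ⟨n, hn, hx⟩ := hN (g N)
    ⟨_, (memAt_h _ _).2 ⟨N, g N, rfl, rfl, hQ.refl _ (hg N)⟩⟩
  obtain ⟨m, _, rfl, rfl, le⟩ := (memAt_h _ _).1 hx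
  exact ⟨m, N, g m, g N, (left_le_pair _ _).trans_lt hn, ⟨m, rfl⟩, ⟨N, rfl⟩, le⟩

theorem IsModelRCA0.exists_escaping_sequence (hM : IsModelRCA0 M S) {C : M → M → Prop}
    (hC : IsDelta S fun v : M × M => C v.1 v.2)
    (escape : ∀ N, ∃ x, (∃ k, C x k) ∧ ∀ k < N, ¬ C x k) :
    ∃ X : M → M, graph X ∈ S ∧ ∀ m n, m < n → ∃ k, C (X m) k ∧ ¬ C (X n) k := by
  have stage : IsSigma S fun w : M × M × M =>
      (∀ k < w.2.1, ¬ C w.1 k) ∧ ∃ k < w.2.2, C w.1 k := by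
    have hC' : IsDelta S fun u : M × M × M × M => C u.2.1 u.1 :=
      hC.comp (f := fun u : M × M × M × M => (u.2.1, u.1))
    exact .and (.ball (P := fun k (w : M × M × M) => ¬ C w.1 k) hM hC'.neg)
      (.bex (P := fun k (w : M × M × M) => C w.1 k) hC'.pos)
  obtain ⟨K, hK, stage_K⟩ := hM.exists_choice
    (P := fun N N' => ∃ x, (∀ k < N, ¬ C x k) ∧ ∃ k < N', C x k) (.ex stage) fun N => by
      obtain ⟨x, ⟨k, hk⟩, hN⟩ := escape N
      exact ⟨k + 1, x, hN, k, lt_add_one k, hk⟩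
  obtain ⟨Y, hY, stage_Y⟩ := hM.exists_choice
    (P := fun N x => (∀ k < N, ¬ C x k) ∧ ∃ k < K N, C x k)
    (.app (P := fun N' (v : M × M) => (∀ k < v.1, ¬ C v.2 k) ∧ ∃ k < N', C v.2 k)
      (stage.comp (f := fun u : M × M × M => (u.2.2, u.2.1, u.1))) hK) stage_K
  obtain ⟨b, hb, -, b_succ⟩ := hM.exists_iterate hK 0
  have b_mono : Monotone b := hM.monotone_of_le_add_one hb fun n => by
    obtain ⟨escapes, k, hk, hCk⟩ := stage_Y (b n)
    exact (not_lt.1 fun h => escapes k h hCk).trans (b_succ n ▸ hk.le)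
  refine ⟨Y ∘ b, hM.graph_comp_mem hb hY, fun m n hmn => ?_⟩
  obtain ⟨k, hk, hCk⟩ := (stage_Y (b m)).2
  have k_lt : k < b n := (b_succ m ▸ hk).trans_le (b_mono (Order.add_one_le_of_lt hmn))
  exact ⟨k, hCk, (stage_Y (b n)).1 k k_lt⟩

theorem alex_isNoetherian (hM : IsModelRCA0 M S) (hW : IsWQO S Q L) :
    (alex Q L).IsNoetherian S := by
  obtain ⟨hQ, good_pair⟩ := hW
  have isSpace := alex_isSpace hM hQ
  refine ⟨isSpace, fun h _ f hf subset => ?_⟩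
  by_contra! not_covered
  obtain ⟨X, hX, escapes⟩ := hM.exists_escaping_sequence
    (C := fun x k => (alex Q L).MemAt f x k) (.memAt isSpace.U_mem hf) fun N => by
      obtain ⟨x, hx, hN⟩ := not_covered N
      exact ⟨x, subset x hx, hN⟩
  have mem_carrier (n : M) : X n ∈ Q := by
    obtain ⟨_, ⟨_, _, -, -, hU⟩, -⟩ := escapes n (n + 1) (lt_add_one n)
    exact (pair_mem_prodSet.1 (isSpace.U_subset hU)).1
  obtain ⟨m, n, x, y, hmn, hx, hy, hxy⟩ := good_pair _ hX (isFun_graph mem_carrier)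
  obtain rfl := pair_mem_graph.1 hx
  obtain rfl := pair_mem_graph.1 hy
  obtain ⟨k, hm, hn⟩ := escapes m n hmn
  exact hn (alex_memAt_mono hQ hm hxy)

end QuasiOrder

end SOA

theorem proposition3p6 {M : Type*} [CommSemiring M] [LinearOrder M] [IsStrictOrderedRing M]
    (S : Set (Set M)) (hRCA : SOA.IsModelRCA0 M S)
    (Q L : Set M) (hQ : SOA.IsQuasiOrder S Q L) :
    ((SOA.alex Q L).IsNoetherian S → (SOA.upper Q L).IsNoetherian S) ∧
    (SOA.IsWQO S Q L ↔ (SOA.alex Q L).IsNoetherian S) := by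
  have := hRCA.canonicallyOrderedAdd
  let := hRCA.succAddOrder
  exact ⟨SOA.upper_isNoetherian hRCA hQ, SOA.alex_isNoetherian hRCA,
    SOA.isWQO_of_alex_isNoetherian hRCA hQ⟩
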